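/- Let $\mathcal X_r$ be a real Hilbert space with scalar product $\langle\cdot,\cdot\rangle_r$, let $J_r$ be a bounded operator on $\mathcal X_r$ with $J_r^*=-J_r$ and $J_r^2=-1$, and let $B_r$ be a (possibly unbounded, densely defined) selfadjoint operator on $\mathcal X_r$ that is nonnegative and invertible, i.e. $\langle B_rx,x\rangle_r\ge 0$ for $x\in D(B_r)$ and $B_r:D(B_r)\to\mathcal X_r$ is bijective. Let $\Lambda_r:=B_r^{1/2}$ be its unique nonnegative selfadjoint square root, which is a bijection $D(\Lambda_r)\to\mathcal X_r$, and let $\mathcal V_r:=D(\Lambda_r)$ with the norm $\|X\|_{\mathcal V_r}:=\|\Lambda_rX\|_{\mathcal X_r}$. A function $X_r\in C(\mathbb R,\mathcal V_r)$ is called a solution of $$\dot X_r(t)=J_rB_rX_r(t)\tag{1}$$ if for all $t\in\mathbb R$ we have $\int_0^tX_r(s)\,ds\in D(B_r)$ and $X_r(t)-X_r(0)=J_rB_r\int_0^tX_r(s)\,ds$. The energy is $\mathcal H_0(X):=\tfrac12\langle B_rX,X\rangle_r$, understood as the quadratic form $\tfrac12\|\Lambda_rX\|^2$ for $X\in\mathcal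 V_r$. Let $\mathcal X=\mathcal X_r+i\mathcal X_r$ be the complexification of $\mathcal X_r$, let $B$, $J$ be the complexifications of $B_r$, $J_r$, let $\Lambda:=B^{1/2}$ be the unique nonnegative selfadjoint square root of $B$, and let $H:=\Lambda iJ\Lambda$ with $D(H)=\{Z\in D(\Lambda): J\Lambda Z\in D(\Lambda)\}$. Then: i) For every $X_0\in\mathcal V_r$ there is exactly one solution $X_r\in C(\mathbb R,\mathcal V_r)$ of (1) with $X_r(0)=X_0$, and every solution satisfies $\mathcal H_0(X_r(t))=\mathcal H_0(X_r(0))$ for all $t\in\mathbb R$. ii) $H$ has a spectral resolution, that is, there is a right-continuous nondecreasing family $E(\omega)$, $\omega\in\mathbb R$, of orthogonal projections on $\mathcal X$, tending strongly to $0$ as $\omega\to-\infty$ and to $1$ as $\omega\to\infty$, such that $HZ=\int\omega\,dE(\omega)Z$, with $D(H)$ the set of those $Z$ for which this integral converges. For any such $E$, write $E(\omega)x=E_{rr}(\omega)x+iE_{ir}(\omega)x$ for $x\in\mathcal X_r$, with $E_{rr}(\omega)x,\,E_{ir}(\omega)x\in\mathcal X_r$. Then every solution $X_r\in C(\mathbb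 R,\mathcal V_r)$ of (1) satisfies, for all $t\in\mathbb R$, $$X_r(t)=\Lambda_r^{-1}\int\bigl[\cos\omega t\,dE_{rr}(\omega)+\sin\omega t\,dE_{ir}(\omega)\bigr]\Lambda_rX_r(0),$$ where the integrals of both terms converge in $\mathcal X_r$. Here $\int f\,dF$, for a vector-valued function $F$ on $\mathbb R$, is the Riemann–Stieltjes integral: the norm limit as $a\to-\infty$, $b\to\infty$ of $\int_a^bf\,dF$, each of which is the norm limit of the sums $\sum_k f(\xi_k)\,(F(x_{k+1})-F(x_k))$ over tagged partitions of $[a,b]$ as the mesh tends to $0$. -/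

import Mathlib

open Filter Topology

namespace HamiltonSpectral

noncomputable section

set_option linter.unusedSectionVars false

/-! ### Nonnegative operators and their square roots -/

section SquareRoot

variable {𝕜 E : Type*} [RCLike 𝕜] [NormedAddCommGroup E] [InnerProductSpace 𝕜 E]

/-- The (possibly unbounded) operator `T` is nonnegative: `⟨T x, x⟩ ≥ 0` on its domain. -/
def IsNonneg (T : E →ₗ.[𝕜] E) : Prop :=
  ∀ x : T.domain, 0 ≤ RCLike.re (inner 𝕜 (T x) (x : E))

/-- `S` is a nonnegative selfadjoint square root of `T`: the equality `S ∘ S = T` of unbounded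
operators (with equality of domains) is expressed through the graphs. -/
structure IsPosSqrt [CompleteSpace E] (T S : E →ₗ.[𝕜] E) : Prop where
  selfAdjoint : IsSelfAdjoint S
  nonneg : IsNonneg S
  sq : ∀ x y : E, (x, y) ∈ T.graph ↔ ∃ z : E, (x, z) ∈ S.graph ∧ (z, y) ∈ S.graph

/-- The nonnegative selfadjoint square root `T^{1/2}` (an arbitrary operator if there is none). -/
def opSqrt [CompleteSpace E] (T : E →ₗ.[𝕜] E) : E →ₗ.[𝕜] E :=
  Classical.epsilon (IsPosSqrt T)

end SquareRoot

/-! ### Riemann–Stieltjes integrals with a vector-valued integrator -/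

section Stieltjes

variable {𝕜 E : Type*} [NormedField 𝕜] [NormedAddCommGroup E] [NormedSpace 𝕜 E]

/-- `I = ∫_a^b f dF` (for `a ≤ b`): the sums `∑ f (ξ_i) (F (x_{i+1}) - F (x_i))` over tagged
partitions `a = x_0 ≤ ξ_0 ≤ x_1 ≤ ξ_1 ≤ … ≤ x_n = b` converge in norm to `I` as the mesh
goes to zero. -/
def HasStieltjesIntegralOn (f : ℝ → 𝕜) (F : ℝ → E) (a b : ℝ) (I : E) : Prop :=
  ∀ ε > 0, ∃ δ > 0, ∀ (n : ℕ) (x ξ : ℕ → ℝ), x 0 = a → x n = b →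
    (∀ i < n, x i ≤ ξ i ∧ ξ i ≤ x (i + 1) ∧ x (i + 1) - x i < δ) →
    ‖(∑ i ∈ Finset.range n, f (ξ i) • (F (x (i + 1)) - F (x i))) - I‖ < ε

/-- `I = ∫_ℝ f dF`: all the integrals `∫_a^b f dF` exist, and they converge in norm to `I`
as `a → -∞` and `b → ∞`. -/
def HasStieltjesIntegral (f : ℝ → 𝕜) (F : ℝ → E) (I : E) : Prop :=
  ∃ G : ℝ → ℝ → E, (∀ a b : ℝ, a ≤ b → HasStieltjesIntegralOn f F a b (G a b)) ∧
    Tendsto (fun p : ℝ × ℝ => G p.1 p.2) (atBot ×ˢ atTop) (𝓝 I)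

end Stieltjes

/-! ### Spectral resolutions -/

section SpectralResolution

variable {Y : Type*} [NormedAddCommGroup Y] [InnerProductSpace ℂ Y] [CompleteSpace Y]

/-- `E` is the spectral resolution of `H`: a right-continuous monotone family of orthogonal
projections, increasing from `0` to `1`, with `H = ∫ ω dE(ω)`; here `D(H)` is the set of
vectors on which the integral converges. -/
structure IsSpectralResolution (H : Y →ₗ.[ℂ] Y) (E : ℝ → Y →L[ℂ] Y) : Prop where
  projection : ∀ ω, IsStarProjection (E ω)
  mono : ∀ ω ω' : ℝ, ω ≤ ω' → (E ω).comp (E ω') = E ω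
  right_continuous : ∀ (ω : ℝ) (z : Y), Tendsto (fun μ => E μ z) (𝓝[>] ω) (𝓝 (E ω z))
  tendsto_atBot : ∀ z : Y, Tendsto (fun ω => E ω z) atBot (𝓝 0)
  tendsto_atTop : ∀ z : Y, Tendsto (fun ω => E ω z) atTop (𝓝 z)
  integral : ∀ z w : Y,
    (z, w) ∈ H.graph ↔ HasStieltjesIntegral (fun ω : ℝ => (ω : ℂ)) (fun ω => E ω z) w

/-- The subspace `{z ∈ D(Λ) : J Λ z ∈ D(Λ)}`. -/
def schrodingerDomain (Λ : Y →ₗ.[ℂ] Y) (J : Y →ₗ[ℂ] Y) : Submodule ℂ Y :=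
  (Λ.domain.comap (J ∘ₗ Λ.toFun)).map Λ.domain.subtype

theorem mem_schrodingerDomain {Λ : Y →ₗ.[ℂ] Y} {J : Y →ₗ[ℂ] Y} {z : Y} :
    z ∈ schrodingerDomain Λ J ↔ ∃ h : z ∈ Λ.domain, J (Λ ⟨z, h⟩) ∈ Λ.domain := by
  constructor
  · rintro ⟨w, hw, rfl⟩
    exact ⟨w.2, hw⟩
  · rintro ⟨h, h'⟩
    exact ⟨⟨z, h⟩, h', rfl⟩

theorem schrodingerDomain_le (Λ : Y →ₗ.[ℂ] Y) (J : Y →ₗ[ℂ] Y) :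
    schrodingerDomain Λ J ≤ Λ.domain :=
  fun _ hz => (mem_schrodingerDomain.1 hz).1

/-- The operator `H = Λ i J Λ` on `D(H) = {z ∈ D(Λ) : J Λ z ∈ D(Λ)}`. -/
def schrodingerOp (Λ : Y →ₗ.[ℂ] Y) (J : Y →ₗ[ℂ] Y) : Y →ₗ.[ℂ] Y where
  domain := schrodingerDomain Λ J
  toFun := Λ.toFun ∘ₗ LinearMap.codRestrict Λ.domain
    ((Complex.I • J) ∘ₗ Λ.toFun ∘ₗ Submodule.inclusion (schrodingerDomain_le Λ J))
    (fun z => Λ.domain.smul_mem Complex.I (mem_schrodingerDomain.1 z.2).2)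

end SpectralResolution

/-! ### The complexification of a real Hilbert space and of its operators -/

/-- The complexification `X ⊕ iX` of a real Hilbert space `X`, normed by
`‖x + iy‖² = ‖x‖² + ‖y‖²`. -/
def Complexification (X : Type*) : Type _ := WithLp 2 (X × X)

namespace Complexification

variable {X : Type*} [NormedAddCommGroup X] [InnerProductSpace ℝ X]

instance : NormedAddCommGroup (Complexification X) :=
  inferInstanceAs (NormedAddCommGroup (WithLp 2 (X × X)))

instance [CompleteSpace X] : CompleteSpace (Complexification X) :=
  inferInstanceAs (CompleteSpace (WithLp 2 (X × X)))

/-- The vector `x + iy`. -/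
def mk (x y : X) : Complexification X := WithLp.toLp 2 (x, y)

/-- The real part of `x + iy`. -/
def re (z : Complexification X) : X := WithLp.fst z

/-- The imaginary part of `x + iy`. -/
def im (z : Complexification X) : X := WithLp.snd z

@[simp] theorem re_mk (x y : X) : re (mk x y) = x := rfl
@[simp] theorem im_mk (x y : X) : im (mk x y) = y := rfl
@[simp] theorem re_add (z w : Complexification X) : re (z + w) = re z + re w := rfl
@[simp] theorem im_add (z w : Complexification X) : im (z + w) = im z + im w := rfl
@[simp] theorem re_zero : re (0 : Complexification X) = 0 := rfl
@[simp] theorem im_zero : im (0 : Complexification X) = 0 := rfl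

theorem ext {z w : Complexification X} (h₁ : re z = re w) (h₂ : im z = im w) : z = w :=
  WithLp.ofLp_injective 2 (Prod.ext h₁ h₂)

instance : SMul ℂ (Complexification X) where
  smul c z := mk (c.re • re z - c.im • im z) (c.re • im z + c.im • re z)

@[simp] theorem re_smul (c : ℂ) (z : Complexification X) :
    re (c • z) = c.re • re z - c.im • im z := rfl
@[simp] theorem im_smul (c : ℂ) (z : Complexification X) :
    im (c • z) = c.re • im z + c.im • re z := rfl

instance : Module ℂ (Complexification X) where
  one_smul z := by apply ext <;> simp
  mul_smul a b z := by
    apply ext <;> simp only [re_smul, im_smul, Complex.mul_re, Complex.mul_im] <;> module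
  smul_zero a := by apply ext <;> simp
  smul_add a z w := by
    apply ext <;> simp only [re_smul, im_smul, re_add, im_add] <;> module
  add_smul a b z := by
    apply ext <;> simp only [re_smul, im_smul, re_add, im_add, Complex.add_re, Complex.add_im] <;>
      module
  zero_smul z := by apply ext <;> simp

theorem norm_sq (z : Complexification X) : ‖z‖ ^ 2 = ‖re z‖ ^ 2 + ‖im z‖ ^ 2 :=
  WithLp.prod_norm_sq_eq_of_L2 (α := X) (β := X) z

/-- `⟨x + iy, x' + iy'⟩ = ⟨x, x'⟩ + ⟨y, y'⟩ + i (⟨x, y'⟩ - ⟨y, x'⟩)`: the sesquilinear extension,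
conjugate linear in the first argument. -/
instance : Inner ℂ (Complexification X) where
  inner z w :=
    ⟨inner ℝ (re z) (re w) + inner ℝ (im z) (im w), inner ℝ (re z) (im w) - inner ℝ (im z) (re w)⟩

theorem inner_def (z w : Complexification X) : inner ℂ z w =
    ⟨inner ℝ (re z) (re w) + inner ℝ (im z) (im w),
      inner ℝ (re z) (im w) - inner ℝ (im z) (re w)⟩ := rfl

instance : InnerProductSpace ℂ (Complexification X) where
  norm_smul_le c z := by
    apply le_of_eq
    have h : ‖c • z‖ ^ 2 = (‖c‖ * ‖z‖) ^ 2 := by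
      rw [mul_pow, norm_sq, norm_sq, re_smul, im_smul, norm_sub_sq_real, norm_add_sq_real,
        ← Complex.normSq_eq_norm_sq, Complex.normSq_apply]
      simp only [norm_smul, inner_smul_left, inner_smul_right, mul_pow, Real.norm_eq_abs, sq_abs,
        conj_trivial, real_inner_comm (re z) (im z)]
      ring
    exact (sq_eq_sq₀ (norm_nonneg _) (by positivity)).1 h
  norm_sq_eq_re_inner z := by
    rw [norm_sq, inner_def]
    simp
  conj_inner_symm z w := by
    rw [inner_def, inner_def]
    apply Complex.ext
    · simp [real_inner_comm]
    · simp [real_inner_comm]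
  add_left z w v := by
    simp only [inner_def]
    apply Complex.ext
    · simp [inner_add_left]; ring
    · simp [inner_add_left]; ring
  smul_left z w c := by
    simp only [inner_def]
    apply Complex.ext
    · simp [inner_add_left, inner_sub_left, inner_smul_left]; ring
    · simp [inner_add_left, inner_sub_left, inner_smul_left]; ring

/-- The embedding `x ↦ x + i0` of `X` into its complexification. -/
def ofReal (x : X) : Complexification X := mk x 0

/-- The complexification `x + iy ↦ T x + i T y` of an everywhere defined operator. -/
def mapLinear (T : X →ₗ[ℝ] X) : Complexification X →ₗ[ℂ] Complexification X where
  toFun z := mk (T (re z)) (T (im z))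
  map_add' z w := by apply ext <;> simp
  map_smul' c z := by apply ext <;> simp

/-- The complexification `x + iy ↦ T x + i T y` of a possibly unbounded operator, on the domain
`D(T) + i D(T)`. -/
def mapLinearPMap (T : X →ₗ.[ℝ] X) : Complexification X →ₗ.[ℂ] Complexification X where
  domain :=
    { carrier := {z | re z ∈ T.domain ∧ im z ∈ T.domain}
      add_mem' := fun hz hw => ⟨T.domain.add_mem hz.1 hw.1, T.domain.add_mem hz.2 hw.2⟩
      zero_mem' := ⟨T.domain.zero_mem, T.domain.zero_mem⟩
      smul_mem' := fun c _ hz =>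
        ⟨T.domain.sub_mem (T.domain.smul_mem c.re hz.1) (T.domain.smul_mem c.im hz.2),
          T.domain.add_mem (T.domain.smul_mem c.re hz.2) (T.domain.smul_mem c.im hz.1)⟩ }
  toFun :=
    { toFun := fun z => mk (T ⟨re z, z.2.1⟩) (T ⟨im z, z.2.2⟩)
      map_add' := by
        intro z w
        apply ext
        · simp only [re_mk, re_add]; rw [← T.map_add]; rfl
        · simp only [im_mk, im_add]; rw [← T.map_add]; rfl
      map_smul' := by
        intro c z
        apply ext
        · simp only [re_mk, im_mk, re_smul, RingHom.id_apply]
          rw [← T.map_smul, ← T.map_smul, ← T.map_sub]; rfl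
        · simp only [re_mk, im_mk, im_smul, RingHom.id_apply]
          rw [← T.map_smul, ← T.map_smul, ← T.map_add]; rfl }

end Complexification

/-! ### The real Hamilton equation -/

section Hamilton

variable {X : Type*} [NormedAddCommGroup X] [InnerProductSpace ℝ X] [CompleteSpace X]

/-- The space `𝒱 = D(B^{1/2})`. It carries the norm `‖x‖ = ‖B^{1/2} x‖`, not that of `X`. -/
def EnergySpace (B : X →ₗ.[ℝ] X) : Type _ := (opSqrt B).domain

namespace EnergySpace

variable {B : X →ₗ.[ℝ] X}

instance : AddCommGroup (EnergySpace B) := inferInstanceAs (AddCommGroup (opSqrt B).domain)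

instance : Module ℝ (EnergySpace B) := inferInstanceAs (Module ℝ (opSqrt B).domain)

/-- The operator `Λ = B^{1/2}` as a map `𝒱 → X`. -/
def sqrtMap (B : X →ₗ.[ℝ] X) : EnergySpace B →ₗ[ℝ] X := (opSqrt B).toFun

/-- The inclusion of `𝒱` in `X`. -/
def incl (B : X →ₗ.[ℝ] X) : EnergySpace B →ₗ[ℝ] X := (opSqrt B).domain.subtype

instance : SeminormedAddCommGroup (EnergySpace B) :=
  SeminormedAddCommGroup.induced (EnergySpace B) X (sqrtMap B)

theorem norm_def (x : EnergySpace B) : ‖x‖ = ‖sqrtMap B x‖ := rfl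

/-- The Hamilton functional `½ ⟨B x, x⟩` for `x` in the form domain `𝒱`, where
`⟨B x, x⟩ = ⟨B^{1/2} x, B^{1/2} x⟩`. -/
def energy (B : X →ₗ.[ℝ] X) (x : EnergySpace B) : ℝ :=
  1 / 2 * inner ℝ (sqrtMap B x) (sqrtMap B x)

end EnergySpace

/-- `u` is a mild solution of `u' = J B u`, that is, `u(t) - u(0) = J B ∫_0^t u(s) ds` for all `t`,
where the integral has to lie in `D(B)`. As the embedding of `𝒱` in `X` is continuous, the
integral may be taken in `X`. -/
def IsMildSolution (J : X →L[ℝ] X) (B : X →ₗ.[ℝ] X) (u : C(ℝ, EnergySpace B)) : Prop :=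
  ∀ t : ℝ, ∃ h : (∫ s in (0 : ℝ)..t, EnergySpace.incl B (u s)) ∈ B.domain,
    EnergySpace.incl B (u t) - EnergySpace.incl B (u 0) = J (B ⟨_, h⟩)

/-- The selfadjoint operator `H = Λ i J Λ` in the complexification of `X`, where `Λ` is the
square root of the complexification of `B`. -/
def complexGenerator (J : X →L[ℝ] X) (B : X →ₗ.[ℝ] X) :
    Complexification X →ₗ.[ℂ] Complexification X :=
  schrodingerOp (opSqrt (Complexification.mapLinearPMap B))
    (Complexification.mapLinear (J : X →ₗ[ℝ] X))

/-- The real component of the restriction of `E` to `X`. -/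
def realComponent (E : ℝ → Complexification X →L[ℂ] Complexification X) (ω : ℝ) (x : X) : X :=
  (E ω (Complexification.ofReal x)).re

/-- The imaginary component of the restriction of `E` to `X`. -/
def imagComponent (E : ℝ → Complexification X →L[ℂ] Complexification X) (ω : ℝ) (x : X) : X :=
  (E ω (Complexification.ofReal x)).im

/-- If `B` has a nonnegative selfadjoint square root then the Hamilton functional on `D(B) ⊆ 𝒱`
is literally `½ ⟨B x, x⟩`. -/
theorem EnergySpace.energy_eq_of_graph {B : X →ₗ.[ℝ] X} (hB : ∃ S, IsPosSqrt B S)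
    (x : B.domain) : ∃ v : EnergySpace B, EnergySpace.incl B v = x ∧
      EnergySpace.energy B v = 1 / 2 * inner ℝ (B x) (x : X) := by
  have hS : IsPosSqrt B (opSqrt B) := Classical.epsilon_spec hB
  obtain ⟨z, hxz, hzy⟩ := (hS.sq x (B x)).1 (B.mem_graph x)
  obtain ⟨v, hv, hvz⟩ := (LinearPMap.mem_graph_iff _).1 hxz
  obtain ⟨w, hw, hwy⟩ := (LinearPMap.mem_graph_iff _).1 hzy
  have had : (opSqrt B).IsFormalAdjoint (opSqrt B) := by
    have h := LinearPMap.adjoint_isFormalAdjoint hS.selfAdjoint.dense_domain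
    rwa [show (opSqrt B).adjoint = opSqrt B from hS.selfAdjoint] at h
  refine ⟨v, hv, ?_⟩
  have h := had v w
  have h1 : EnergySpace.sqrtMap B v = z := hvz
  rw [hwy, hvz, hw, hv] at h
  change 1 / 2 * inner ℝ (EnergySpace.sqrtMap B v) (EnergySpace.sqrtMap B v) = _
  have h' : inner ℝ z z = inner ℝ (x : X) (B x) := h
  rw [h1, h', real_inner_comm]

end Hamilton

end

end HamiltonSpectral

open HamiltonSpectral

/-! Every unbounded operator involved is invertible with bounded inverse, so the whole argument is
carried out with bounded operators. Writing `R` for `Λ_r⁻¹`, one has `B_r⁻¹ = R²`, and since `(iJ)²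
= 1` the operator `H = Λ iJ Λ` is the inverse of the bounded selfadjoint injective operator `K = i R
J R` on the complexification. In the coordinate `y = Λ_r X_r` equation (1) becomes `y' = -iHy`, that
is, in mild form, `K (y t - y 0) = -i ∫ y`.

For such a mild solution `K y` is differentiable and `‖K y‖` is constant because `K` is symmetric;
applied to differences of time shifts this makes `‖y‖` constant too (`IsEvolution.norm_eq`). This is
energy conservation, and linearity gives uniqueness. For initial values in the dense range of `K`
the solution is `K e^{-it/K} z`, defined by continuous functional calculus, and the isometry
property extends existence to all initial values. As `K` is `i` times a real operator, real parts of
solutions are solutions.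

The spectral projection of `H` for `(-∞, ω]` projects onto the kernel of `f(K)`, where `f(k) = (k -
ωk²)⁺ = k² (1/k - ω)⁺`, so continuous functions suffice. Its key property is that on the range of `E
b - E a` the operator `H` differs from any `ξ` in `[a, b]` by at most `b - a`. `IsSpectralFamily`
states this through `K`; it is equivalent to being a spectral resolution of `H = K⁻¹`
(`IsSpectralFamily.isSpectralResolution`, `IsSpectralResolution.isSpectralFamily`), so the
representation holds for every resolution.

On a short spectral interval a solution almost rotates like `e^{-iξt}`. Orthogonality of the pieces
adds up these errors without loss, whence `y t = ∫ e^{-iωt} dE(ω) y 0`. Combining times `t` and `-t`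
isolates cosine and sine, whose real and imaginary components give the formula. -/

namespace HamiltonSpectral

noncomputable section

set_option linter.unusedSectionVars false

/-! ### Unbounded operators as inverses of bounded ones -/

section GraphInverse

variable {𝕜 E : Type*} [RCLike 𝕜] [NormedAddCommGroup E] [InnerProductSpace 𝕜 E]

/-- The unbounded operator `T` is the inverse of the everywhere defined operator `A`. -/
def IsInverseOf (T : E →ₗ.[𝕜] E) (A : E →L[𝕜] E) : Prop :=
  ∀ x y : E, (x, y) ∈ T.graph ↔ A y = x

theorem IsInverseOf.ext {S T : E →ₗ.[𝕜] E} {A : E →L[𝕜] E} (hS : IsInverseOf S A)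
    (hT : IsInverseOf T A) : S = T := by
  apply LinearPMap.eq_of_eq_graph
  ext ⟨x, y⟩
  rw [hS, hT]

theorem IsInverseOf.injective {T : E →ₗ.[𝕜] E} {A : E →L[𝕜] E} (h : IsInverseOf T A) :
    Function.Injective A := by
  rw [injective_iff_map_eq_zero]
  intro y hy
  exact T.graph_fst_eq_zero_snd ((h 0 y).2 hy) rfl

theorem IsInverseOf.bijective {T : E →ₗ.[𝕜] E} {A : E →L[𝕜] E} (h : IsInverseOf T A) :
    Function.Bijective T := by
  constructor
  · intro x y hxy
    have hx := (h x (T x)).1 (T.mem_graph x)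
    have hy := (h y (T y)).1 (T.mem_graph y)
    rw [hxy, hy] at hx
    exact Subtype.ext hx.symm
  · intro y
    obtain ⟨x, -, hx⟩ := (LinearPMap.mem_graph_iff _).1 ((h (A y) y).2 rfl)
    exact ⟨x, hx⟩

theorem exists_isInverseOf_of_injective {A : E →L[𝕜] E} (hA : Function.Injective A) :
    ∃ T, IsInverseOf T A := by
  let f : E →ₗ.[𝕜] E := (A : E →ₗ[𝕜] E).toPMap ⊤
  have hf : LinearMap.ker f.toFun = ⊥ := by
    rw [LinearMap.ker_eq_bot]
    intro x y hxy
    exact Subtype.ext (hA hxy)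
  refine ⟨f.inverse, fun x y => ?_⟩
  rw [LinearPMap.inverse_graph hf]
  constructor
  · rintro ⟨⟨a, b⟩, hab, h⟩
    obtain ⟨c, hc, hc'⟩ := (LinearPMap.mem_graph_iff _).1 hab
    simp only [LinearEquiv.coe_coe, LinearEquiv.prodComm_apply, Prod.swap_prod_mk,
      Prod.mk.injEq] at h
    rw [← h.1, ← h.2]
    exact (congrArg A hc).symm.trans hc'
  · rintro rfl
    exact ⟨(y, A y), (LinearPMap.mem_graph_iff _).2 ⟨⟨y, trivial⟩, rfl, rfl⟩, rfl⟩

variable [CompleteSpace E]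

/-- The inverse is symmetric and defined everywhere, hence bounded by Hellinger–Toeplitz; positivity
is that of `T` read at `A y`. -/
theorem exists_isPositive_isInverseOf {T : E →ₗ.[𝕜] E} (hT : IsSelfAdjoint T)
    (hT0 : IsNonneg T) (hinv : Function.Bijective T) :
    ∃ A : E →L[𝕜] E, A.IsPositive ∧ IsInverseOf T A := by
  let e : T.domain ≃ₗ[𝕜] E := LinearEquiv.ofBijective T.toFun hinv
  let L : E →ₗ[𝕜] E := T.domain.subtype ∘ₗ (e.symm : E →ₗ[𝕜] T.domain)
  have he : ∀ y, T (e.symm y) = y := fun y => e.apply_symm_apply y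
  have had : T.IsFormalAdjoint T := by
    have h := LinearPMap.adjoint_isFormalAdjoint hT.dense_domain
    rwa [show T.adjoint = T from hT] at h
  have hsymm : L.IsSymmetric := by
    intro x y
    have h := had (e.symm x) (e.symm y)
    rw [he, he] at h
    exact h.symm
  refine ⟨⟨L, hsymm.continuous⟩, ⟨hsymm, fun x => ?_⟩, fun x y => ?_⟩
  · have h := hT0 (e.symm x)
    rw [he] at h
    rw [ContinuousLinearMap.reApplyInnerSelf_apply, ← inner_conj_symm, RCLike.conj_re]
    exact h
  · constructor
    · intro h
      obtain ⟨c, hc, hc'⟩ := (LinearPMap.mem_graph_iff _).1 h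
      have : e c = y := hc'
      change ((e.symm y : T.domain) : E) = x
      rw [← this, e.symm_apply_apply]
      exact hc
    · rintro rfl
      exact (LinearPMap.mem_graph_iff _).2 ⟨e.symm y, rfl, he y⟩

/-- A vector `x` orthogonal to the range of `A` satisfies `‖A x‖² = ⟨A (A x), x⟩ = 0`, and `A` is
injective. -/
theorem IsInverseOf.dense_domain {T : E →ₗ.[𝕜] E} {A : E →L[𝕜] E} (hA : A.IsPositive)
    (h : IsInverseOf T A) : Dense (T.domain : Set E) := by
  rw [Submodule.dense_iff_topologicalClosure_eq_top,
    Submodule.topologicalClosure_eq_top_iff, Submodule.eq_bot_iff]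
  intro x hx
  apply h.injective
  rw [map_zero, ← inner_self_eq_zero (𝕜 := 𝕜)]
  have h1 : A (A x) ∈ T.domain :=
    LinearPMap.mem_domain_of_mem_graph ((h _ (A x)).2 rfl)
  have h2 := (Submodule.mem_orthogonal _ _).1 hx _ h1
  rwa [show inner 𝕜 (A (A x)) x = inner 𝕜 (A x) (A x) from hA.isSymmetric _ _] at h2

theorem IsInverseOf.isSelfAdjoint {T : E →ₗ.[𝕜] E} {A : E →L[𝕜] E} (hA : A.IsPositive)
    (h : IsInverseOf T A) : IsSelfAdjoint T := by
  have hd := h.dense_domain hA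
  apply LinearPMap.eq_of_eq_graph
  change T.adjoint.graph = T.graph
  rw [LinearPMap.adjoint_graph_eq_graph_adjoint hd]
  ext ⟨x, y⟩
  rw [Submodule.mem_adjoint_iff, h]
  constructor
  · intro H
    apply ext_inner_left 𝕜
    intro v
    have h1 := H (A v) v ((h _ _).2 rfl)
    rw [sub_eq_zero] at h1
    rw [h1, ← show inner 𝕜 (A v) y = inner 𝕜 v (A y) from hA.isSymmetric _ _]
  · rintro rfl a b hab
    obtain rfl := (h _ _).1 hab
    rw [sub_eq_zero, ← show inner 𝕜 (A b) y = inner 𝕜 b (A y) from hA.isSymmetric _ _]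

theorem IsInverseOf.isNonneg {T : E →ₗ.[𝕜] E} {A : E →L[𝕜] E} (hA : A.IsPositive)
    (h : IsInverseOf T A) : IsNonneg T := by
  intro x
  have h1 := (h x (T x)).1 (T.mem_graph x)
  have h2 := hA.2 (T x)
  rw [ContinuousLinearMap.reApplyInnerSelf_apply, ← inner_conj_symm, RCLike.conj_re] at h2
  rwa [h1] at h2

/-- Reduces square roots of unbounded operators to bounded ones. A square root `S` inherits
injectivity and surjectivity from `T` through the graph identity, so it has a positive bounded
inverse, whose square inverts `T`. -/
theorem isPosSqrt_iff {T S : E →ₗ.[𝕜] E} {A : E →L[𝕜] E} (h : IsInverseOf T A) :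
    IsPosSqrt T S ↔ ∃ Q : E →L[𝕜] E, Q.IsPositive ∧ Q * Q = A ∧ IsInverseOf S Q := by
  constructor
  · intro hS
    have hbij : Function.Bijective S := by
      constructor
      · refine (injective_iff_map_eq_zero S.toFun).2 fun x hx => ?_
        have h1 : ((x : E), (0 : E)) ∈ S.graph := (LinearPMap.mem_graph_iff _).2 ⟨x, rfl, hx⟩
        have h2 := (hS.sq x 0).2 ⟨0, h1, S.graph.zero_mem⟩
        rw [h, map_zero] at h2
        exact Subtype.ext h2.symm
      · intro y
        obtain ⟨z, -, hz⟩ := (hS.sq _ y).1 ((h _ y).2 rfl)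
        obtain ⟨c, -, hc⟩ := (LinearPMap.mem_graph_iff _).1 hz
        exact ⟨c, hc⟩
    obtain ⟨Q, hQ, hSQ⟩ := exists_isPositive_isInverseOf hS.selfAdjoint hS.nonneg hbij
    refine ⟨Q, hQ, ?_, hSQ⟩
    ext y
    symm
    rw [← h, hS.sq]
    exact ⟨Q y, (hSQ _ _).2 rfl, (hSQ _ _).2 rfl⟩
  · rintro ⟨Q, hQ, rfl, hSQ⟩
    refine ⟨hSQ.isSelfAdjoint hQ, hSQ.isNonneg hQ, fun x y => ?_⟩
    rw [h]
    constructor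
    · rintro rfl
      exact ⟨Q y, (hSQ _ _).2 rfl, (hSQ _ _).2 rfl⟩
    · rintro ⟨z, h1, h2⟩
      rw [hSQ] at h1 h2
      rw [← h1, ← h2]
      rfl

/-- Square roots of `A⁻¹` correspond to square roots of `A`. -/
theorem existsUnique_isPosSqrt {T : E →ₗ.[𝕜] E} {A : E →L[𝕜] E} (h : IsInverseOf T A)
    (hQ : ∃! Q : E →L[𝕜] E, Q.IsPositive ∧ Q * Q = A) : ∃! S, IsPosSqrt T S := by
  obtain ⟨Q, ⟨hQ0, hQA⟩, huniq⟩ := hQ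
  have hinj : Function.Injective Q := by
    intro x y hxy
    apply h.injective
    rw [← hQA]
    exact congrArg Q hxy
  obtain ⟨S, hS⟩ := exists_isInverseOf_of_injective hinj
  refine ⟨S, (isPosSqrt_iff h).2 ⟨Q, hQ0, hQA, hS⟩, fun S' hS' => ?_⟩
  obtain ⟨Q', hQ', hQA', hSQ'⟩ := (isPosSqrt_iff h).1 hS'
  obtain rfl := huniq Q' ⟨hQ', hQA'⟩
  exact hSQ'.ext hS

end GraphInverse

/-! ### Real and imaginary parts, complexified operators, conjugation -/

namespace Complexification

variable {X : Type*} [NormedAddCommGroup X] [InnerProductSpace ℝ X]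

@[simp] theorem re_real_smul (r : ℝ) (z : Complexification X) : re (r • z) = r • re z := by
  rw [← Complex.coe_smul, re_smul]; simp

@[simp] theorem im_real_smul (r : ℝ) (z : Complexification X) : im (r • z) = r • im z := by
  rw [← Complex.coe_smul, im_smul]; simp

theorem norm_re_le (z : Complexification X) : ‖re z‖ ≤ ‖z‖ := by
  apply le_of_sq_le_sq _ (norm_nonneg z)
  rw [norm_sq]
  nlinarith [sq_nonneg ‖im z‖]

theorem norm_im_le (z : Complexification X) : ‖im z‖ ≤ ‖z‖ := by
  apply le_of_sq_le_sq _ (norm_nonneg z)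
  rw [norm_sq]
  nlinarith [sq_nonneg ‖re z‖]

/-- The real part as a continuous real linear map. -/
def reCLM : Complexification X →L[ℝ] X :=
  LinearMap.mkContinuous ⟨⟨re, re_add⟩, re_real_smul⟩ 1 fun z => by
    rw [one_mul]; exact norm_re_le z

/-- The imaginary part as a continuous real linear map. -/
def imCLM : Complexification X →L[ℝ] X :=
  LinearMap.mkContinuous ⟨⟨im, im_add⟩, im_real_smul⟩ 1 fun z => by
    rw [one_mul]; exact norm_im_le z

@[simp] theorem reCLM_apply (z : Complexification X) : reCLM z = re z := rfl
@[simp] theorem imCLM_apply (z : Complexification X) : imCLM z = im z := rfl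

@[simp] theorem re_ofReal (x : X) : re (ofReal x) = x := rfl
@[simp] theorem im_ofReal (x : X) : im (ofReal x) = 0 := rfl
@[simp] theorem re_sub (z w : Complexification X) : re (z - w) = re z - re w :=
  reCLM.map_sub z w
@[simp] theorem im_sub (z w : Complexification X) : im (z - w) = im z - im w :=
  imCLM.map_sub z w
@[simp] theorem re_neg (z : Complexification X) : re (-z) = - re z :=
  reCLM.map_neg z
@[simp] theorem im_neg (z : Complexification X) : im (-z) = - im z :=
  imCLM.map_neg z

/-- The embedding of `X` in its complexification as a continuous real linear map. -/
def ofRealCLM : X →L[ℝ] Complexification X :=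
  LinearMap.mkContinuous
    ⟨⟨ofReal, fun x y => by apply ext <;> simp⟩, fun r x => by apply ext <;> simp⟩ 1 fun x => by
      apply le_of_sq_le_sq _ (by positivity)
      rw [norm_sq]
      simp

@[simp] theorem ofRealCLM_apply (x : X) : ofRealCLM x = ofReal x := rfl

/-- The complexification of a bounded operator. -/
def mapCLM (T : X →L[ℝ] X) : Complexification X →L[ℂ] Complexification X :=
  LinearMap.mkContinuous (mapLinear (T : X →ₗ[ℝ] X)) ‖T‖ fun z => by
    apply le_of_sq_le_sq _ (by positivity)
    rw [norm_sq, mul_pow, norm_sq, mul_add, ← mul_pow, ← mul_pow]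
    change ‖T (re z)‖ ^ 2 + ‖T (im z)‖ ^ 2 ≤ _
    gcongr <;> exact T.le_opNorm _

@[simp] theorem re_mapCLM (T : X →L[ℝ] X) (z : Complexification X) :
    re (mapCLM T z) = T (re z) := rfl
@[simp] theorem im_mapCLM (T : X →L[ℝ] X) (z : Complexification X) :
    im (mapCLM T z) = T (im z) := rfl

theorem mapCLM_ofReal (T : X →L[ℝ] X) (x : X) : mapCLM T (ofReal x) = ofReal (T x) := by
  apply ext <;> simp

theorem mapCLM_injective : Function.Injective (mapCLM (X := X)) := by
  intro S T h
  ext x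
  exact congrArg re (DFunLike.congr_fun h (ofReal x))

theorem mapCLM_mul (S T : X →L[ℝ] X) : mapCLM (S * T) = mapCLM S * mapCLM T := rfl

theorem inner_re (z w : Complexification X) :
    (inner ℂ z w).re = inner ℝ (re z) (re w) + inner ℝ (im z) (im w) := rfl

theorem mapCLM_isPositive {T : X →L[ℝ] X} (hT : T.IsPositive) : (mapCLM T).IsPositive := by
  have hs : ∀ x y, inner ℝ (T x) y = inner ℝ x (T y) := hT.isSymmetric
  refine ⟨fun z w => ?_, fun z => ?_⟩
  · change inner ℂ (mapCLM T z) w = inner ℂ z (mapCLM T w)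
    rw [inner_def, inner_def]
    simp [hs]
  · exact add_nonneg (hT.2 (re z)) (hT.2 (im z))

theorem isPositive_of_mapCLM {T : X →L[ℝ] X} (hT : (mapCLM T).IsPositive) : T.IsPositive := by
  have hs : ∀ z w : Complexification X,
      inner ℂ (mapCLM T z) w = inner ℂ z (mapCLM T w) := hT.isSymmetric
  refine ⟨fun x y => ?_, fun x => ?_⟩
  · have h := congrArg Complex.re (hs (ofReal x) (ofReal y))
    rw [inner_re, inner_re] at h
    simpa using h
  · have h := hT.2 (ofReal x)
    rw [ContinuousLinearMap.reApplyInnerSelf_apply] at h ⊢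
    change 0 ≤ (inner ℂ (mapCLM T (ofReal x)) (ofReal x)).re at h
    rw [inner_re] at h
    simpa using h

/-- Complex conjugation `x + iy ↦ x - iy`. -/
def conj (z : Complexification X) : Complexification X := mk (re z) (-im z)

@[simp] theorem re_conj (z : Complexification X) : re (conj z) = re z := rfl
@[simp] theorem im_conj (z : Complexification X) : im (conj z) = -im z := rfl

theorem conj_conj (z : Complexification X) : conj (conj z) = z := by
  apply ext <;> simp

theorem norm_conj (z : Complexification X) : ‖conj z‖ = ‖z‖ := by
  rw [← sq_eq_sq₀ (norm_nonneg _) (norm_nonneg _), norm_sq, norm_sq]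
  simp

/-- The operator `z ↦ conj (Q (conj z))`. -/
def conjCLM (Q : Complexification X →L[ℂ] Complexification X) :
    Complexification X →L[ℂ] Complexification X :=
  LinearMap.mkContinuous
    { toFun := fun z => conj (Q (conj z))
      map_add' := fun z w => by
        have : conj (z + w) = conj z + conj w := by apply ext <;> simp [add_comm]
        rw [this, map_add]
        apply ext <;> simp [add_comm]
      map_smul' := fun c z => by
        have : conj (c • z) = (starRingEnd ℂ c) • conj z := by
          apply ext <;> simp [add_comm, sub_eq_add_neg]
        rw [this, map_smul]
        apply ext <;> simp [add_comm, sub_eq_add_neg] } ‖Q‖ fun z => by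
    change ‖conj (Q (conj z))‖ ≤ _
    rw [norm_conj, ← norm_conj z]
    exact Q.le_opNorm _

theorem conjCLM_apply (Q : Complexification X →L[ℂ] Complexification X)
    (z : Complexification X) : conjCLM Q z = conj (Q (conj z)) := rfl

theorem inner_conj_conj (z w : Complexification X) :
    inner ℂ (conj z) (conj w) = inner ℂ w z := by
  rw [inner_def, inner_def]
  apply Complex.ext <;> simp [real_inner_comm]
  ring

/-- Conjugation is antiunitary: it swaps the two arguments of the inner product, which symmetry of
`Q` undoes. -/
theorem conjCLM_isPositive {Q : Complexification X →L[ℂ] Complexification X}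
    (hQ : Q.IsPositive) : (conjCLM Q).IsPositive := by
  have hs : ∀ z w, inner ℂ (Q z) w = inner ℂ z (Q w) := hQ.isSymmetric
  refine ⟨fun z w => ?_, fun z => ?_⟩
  · change inner ℂ (conjCLM Q z) w = inner ℂ z (conjCLM Q w)
    rw [conjCLM_apply, conjCLM_apply, ← inner_conj_conj, conj_conj, ← hs, ← inner_conj_conj,
      conj_conj]
  · have h := hQ.2 (conj z)
    rw [ContinuousLinearMap.reApplyInnerSelf_apply] at h ⊢
    rwa [conjCLM_apply, ← inner_conj_conj, conj_conj, ← hs]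

variable [CompleteSpace X]

theorem isInverseOf_mapLinearPMap {B : X →ₗ.[ℝ] X} {A : X →L[ℝ] X} (h : IsInverseOf B A) :
    IsInverseOf (mapLinearPMap B) (mapCLM A) := by
  intro z w
  constructor
  · intro hzw
    obtain ⟨c, hc, hc'⟩ := (LinearPMap.mem_graph_iff _).1 hzw
    have h1 := (h (re (c : Complexification X)) (re w)).1
      ((LinearPMap.mem_graph_iff _).2 ⟨⟨_, c.2.1⟩, rfl, congrArg re hc'⟩)
    have h2 := (h (im (c : Complexification X)) (im w)).1
      ((LinearPMap.mem_graph_iff _).2 ⟨⟨_, c.2.2⟩, rfl, congrArg im hc'⟩)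
    rw [show z = (c : Complexification X) from hc.symm]
    exact ext h1 h2
  · rintro rfl
    obtain ⟨x, hx, hx'⟩ := (LinearPMap.mem_graph_iff _).1 ((h (A (re w)) (re w)).2 rfl)
    obtain ⟨y, hy, hy'⟩ := (LinearPMap.mem_graph_iff _).1 ((h (A (im w)) (im w)).2 rfl)
    refine (LinearPMap.mem_graph_iff _).2 ⟨⟨mk x y, x.2, y.2⟩, ext hx hy, ext hx' hy'⟩

end Complexification

open Complexification

/-! ### Square roots of bounded positive operators -/

section BoundedSqrt

theorem existsUnique_sqrt_complex {Y : Type*} [NormedAddCommGroup Y] [InnerProductSpace ℂ Y]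
    [CompleteSpace Y] {A : Y →L[ℂ] Y} (hA : A.IsPositive) :
    ∃! Q : Y →L[ℂ] Y, Q.IsPositive ∧ Q * Q = A := by
  have hA' : 0 ≤ A := (ContinuousLinearMap.nonneg_iff_isPositive A).2 hA
  refine ⟨CFC.sqrt A, ⟨(ContinuousLinearMap.nonneg_iff_isPositive _).1 (CFC.sqrt_nonneg A),
    CFC.sqrt_mul_sqrt_self A⟩, ?_⟩
  rintro Q ⟨hQ, hQA⟩
  exact (CFC.sqrt_unique hQA ((ContinuousLinearMap.nonneg_iff_isPositive _).2 hQ)).symm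

variable {X : Type*} [NormedAddCommGroup X] [InnerProductSpace ℝ X] [CompleteSpace X]

/-- The complex square root of a complexified operator is fixed by conjugation, by uniqueness. It
therefore maps `X` into `X` and is itself a complexification; uniqueness over the reals is inherited
from uniqueness over the complex numbers. -/
theorem existsUnique_sqrt_real {A : X →L[ℝ] X} (hA : A.IsPositive) :
    ∃! R : X →L[ℝ] X, R.IsPositive ∧ R * R = A := by
  obtain ⟨Q, ⟨hQ, hQA⟩, huniq⟩ := existsUnique_sqrt_complex (mapCLM_isPositive hA)
  have hconj : conjCLM Q = Q := by
    refine huniq _ ⟨conjCLM_isPositive hQ, ?_⟩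
    ext z
    change conj (Q (conj (conj (Q (conj z))))) = _
    rw [conj_conj]
    change conj ((Q * Q) (conj z)) = _
    rw [hQA]
    apply Complexification.ext <;> simp
  let R : X →L[ℝ] X := reCLM.comp ((Q.restrictScalars ℝ).comp ofRealCLM)
  have hR : ∀ x, Q (ofReal x) = ofReal (R x) := by
    intro x
    apply Complexification.ext
    · rfl
    · have h : - im (Q (ofReal x)) = im (Q (ofReal x)) := by
        have h := congrArg im (DFunLike.congr_fun hconj (ofReal x))
        rwa [conjCLM_apply, im_conj, show conj (ofReal x) = ofReal x by
          apply Complexification.ext <;> simp] at h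
      have h2 : (2 : ℝ) • im (Q (ofReal x)) = 0 := by
        rw [two_smul]
        nth_rewrite 1 [← h]
        exact neg_add_cancel _
      exact (smul_eq_zero.1 h2).resolve_left two_ne_zero
  have hRQ : mapCLM R = Q := by
    ext z
    have hz : z = ofReal (re z) + Complex.I • ofReal (im z) := by
      apply Complexification.ext <;> simp
    rw [hz, map_add, map_add, map_smul, map_smul, hR, hR, mapCLM_ofReal, mapCLM_ofReal]
  refine ⟨R, ⟨isPositive_of_mapCLM (hRQ ▸ hQ), mapCLM_injective ?_⟩, ?_⟩
  · rw [mapCLM_mul, hRQ, hQA]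
  · rintro R' ⟨hR', hRA'⟩
    apply mapCLM_injective
    rw [hRQ]
    exact huniq _ ⟨mapCLM_isPositive hR', by rw [← mapCLM_mul, hRA']⟩

end BoundedSqrt

/-! ### The bounded inverse of `H` -/

section Generator

variable {X : Type*} [NormedAddCommGroup X] [InnerProductSpace ℝ X] [CompleteSpace X]

/-- The inverse of `-J B` in the coordinate `y = B^{1/2} x`, where `R = B^{-1/2}`. -/
def skewInverse (R J : X →L[ℝ] X) : X →L[ℝ] X := R * J * R

/-- The inverse of the complex generator, where `R = B^{-1/2}`. -/
def generatorInverse (R J : X →L[ℝ] X) : Complexification X →L[ℂ] Complexification X :=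
  Complex.I • mapCLM (skewInverse R J)

/-- Since `J² = -1`, the operator `iJ` is its own inverse, so inverting `Λ iJ Λ` factor by factor
gives `R iJ R`. The remaining work is to see that the domain condition `J Λ z ∈ D(Λ)` matches the
range of this product. -/
theorem complexGenerator_isInverseOf {B : X →ₗ.[ℝ] X} {R J : X →L[ℝ] X}
    (h : IsInverseOf (opSqrt (mapLinearPMap B)) (mapCLM R)) (hJ : J.comp J = -1) :
    IsInverseOf (complexGenerator J B) (generatorInverse R J) := by
  have hJ' : ∀ z, mapCLM J (mapCLM J z) = -z := by
    intro z
    have : ∀ x, J (J x) = -x := fun x => DFunLike.congr_fun hJ x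
    apply Complexification.ext <;> simp [this]
  have hK : ∀ w, generatorInverse R J w = mapCLM R (Complex.I • mapCLM J (mapCLM R w)) := by
    intro w
    rw [map_smul]
    rfl
  intro z w
  rw [hK]
  constructor
  · intro hzw
    obtain ⟨c, hc, hc'⟩ := (LinearPMap.mem_graph_iff _).1 hzw
    obtain ⟨h1, h2⟩ := mem_schrodingerDomain.1 c.2
    set Λ := opSqrt (mapLinearPMap B)
    have e1 := (h _ _).1 (Λ.mem_graph ⟨(c : Complexification X), h1⟩)
    have e2 := (h _ _).1 ((LinearPMap.mem_graph_iff _).2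
      ⟨⟨Complex.I • mapCLM J (Λ ⟨(c : Complexification X), h1⟩),
        Λ.domain.smul_mem _ h2⟩, rfl, hc'⟩)
    simp only at e1 e2
    rw [e2, map_smul (mapCLM J), hJ', smul_smul, Complex.I_mul_I, neg_one_smul, neg_neg, e1]
    exact hc
  · rintro rfl
    set Λ := opSqrt (mapLinearPMap B)
    obtain ⟨c, hc, hc'⟩ := (LinearPMap.mem_graph_iff _).1
      ((h (mapCLM R (Complex.I • mapCLM J (mapCLM R w))) _).2 rfl)
    simp only at hc hc'
    have hw : mapCLM R w ∈ Λ.domain :=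
      LinearPMap.mem_domain_of_mem_graph ((h _ w).2 rfl)
    have hJc : mapCLM J (Λ c) = -Complex.I • mapCLM R w := by
      rw [hc', map_smul, hJ', smul_neg, neg_smul]
    have hmem : mapCLM J (Λ c) ∈ Λ.domain := by
      rw [hJc]
      exact Λ.domain.smul_mem _ hw
    refine (LinearPMap.mem_graph_iff _).2 ⟨⟨c, mem_schrodingerDomain.2 ⟨c.2, hmem⟩⟩, hc, ?_⟩
    have hI : Complex.I • mapCLM J (Λ c) = mapCLM R w := by
      rw [hJc, smul_smul, mul_neg, Complex.I_mul_I, neg_neg, one_smul]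
    have hg : (Complex.I • mapCLM J (Λ c), w) ∈ Λ.graph := (h _ _).2 hI.symm
    obtain ⟨d, hd, hd'⟩ := (LinearPMap.mem_graph_iff _).1 hg
    simp only at hd hd'
    rw [← hd']
    exact congrArg Λ (Subtype.ext hd.symm)

theorem skewInverse_inner {R J : X →L[ℝ] X} (hR : R.IsPositive)
    (hJ : ContinuousLinearMap.adjoint J = -J) (x y : X) :
    inner ℝ (skewInverse R J x) y = -inner ℝ x (skewInverse R J y) := by
  have hs : ∀ x y, inner ℝ (R x) y = inner ℝ x (R y) := hR.isSymmetric
  change inner ℝ (R (J (R x))) y = -inner ℝ x (R (J (R y)))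
  rw [hs, ← ContinuousLinearMap.adjoint_inner_right, hJ, ← hs]
  simp

theorem generatorInverse_isSelfAdjoint {R J : X →L[ℝ] X} (hR : R.IsPositive)
    (hJ : ContinuousLinearMap.adjoint J = -J) : IsSelfAdjoint (generatorInverse R J) := by
  rw [ContinuousLinearMap.isSelfAdjoint_iff_isSymmetric]
  intro z w
  change inner ℂ (generatorInverse R J z) w = inner ℂ z (generatorInverse R J w)
  have hs := skewInverse_inner hR hJ
  rw [inner_def, inner_def]
  apply Complex.ext <;> simp [generatorInverse, hs] <;> ring

end Generator

/-! ### Mild solutions of `q' = -i K⁻¹ q`: conservation and uniqueness -/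

section Evolution

variable {Y : Type*} [NormedAddCommGroup Y] [InnerProductSpace ℂ Y] [CompleteSpace Y]

theorem selfAdjoint_inner {K : Y →L[ℂ] Y} (hK : IsSelfAdjoint K) (x y : Y) :
    inner ℂ (K x) y = inner ℂ x (K y) :=
  (ContinuousLinearMap.isSelfAdjoint_iff_isSymmetric.1 hK) x y

theorem denseRange_of_injective {K : Y →L[ℂ] Y} (hK : IsSelfAdjoint K)
    (hinj : Function.Injective K) : DenseRange K := by
  have : Dense (LinearMap.range (K : Y →ₗ[ℂ] Y) : Set Y) := by
    rw [Submodule.dense_iff_topologicalClosure_eq_top,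
      Submodule.topologicalClosure_eq_top_iff, Submodule.eq_bot_iff]
    intro x hx
    apply hinj
    rw [map_zero, ← inner_self_eq_zero (𝕜 := ℂ), ← selfAdjoint_inner hK]
    exact (Submodule.mem_orthogonal _ _).1 hx _ ⟨K x, rfl⟩
  rw [DenseRange]
  exact this

/-- `q` is a mild solution of `q' = -i K⁻¹ q`. -/
structure IsEvolution (K : Y →L[ℂ] Y) (q : ℝ → Y) : Prop where
  continuous : Continuous q
  mild : ∀ t : ℝ, K (q t - q 0) = -(Complex.I • ∫ s in (0 : ℝ)..t, q s)

namespace IsEvolution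

variable {K : Y →L[ℂ] Y} {p q : ℝ → Y}

/-- With `hasDerivAt` below, this trades the integrated equation for a pointwise one: `q` itself
need not be differentiable, but `K q` is. -/
theorem of_hasDerivAt (hq : Continuous q)
    (h : ∀ t, HasDerivAt (fun s => K (q s)) (-(Complex.I • q t)) t) : IsEvolution K q := by
  refine ⟨hq, fun t => ?_⟩
  have h1 := intervalIntegral.integral_eq_sub_of_hasDerivAt (a := 0) (b := t)
    (fun s _ => h s) ((hq.const_smul Complex.I).neg.intervalIntegrable _ _)
  rw [map_sub, ← h1, intervalIntegral.integral_neg, intervalIntegral.integral_smul]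

theorem hasDerivAt (hq : IsEvolution K q) (t : ℝ) :
    HasDerivAt (fun s => K (q s)) (-(Complex.I • q t)) t := by
  have h1 : (fun s => K (q s)) = fun s => K (q 0) + -(Complex.I • ∫ r in (0 : ℝ)..s, q r) := by
    ext s
    rw [← hq.mild s, map_sub]
    abel
  rw [h1]
  have h2 : HasDerivAt (fun s => ∫ r in (0 : ℝ)..s, q r) (q t) t :=
    intervalIntegral.integral_hasDerivAt_right (hq.continuous.intervalIntegrable _ _)
      (hq.continuous.stronglyMeasurableAtFilter _ _) hq.continuous.continuousAt
  exact ((h2.const_smul Complex.I).neg).const_add _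

theorem sub (hp : IsEvolution K p) (hq : IsEvolution K q) :
    IsEvolution K (fun t => p t - q t) :=
  of_hasDerivAt (hp.continuous.sub hq.continuous) fun t => by
    have h := (hp.hasDerivAt t).sub (hq.hasDerivAt t)
    have e : -(Complex.I • (p t - q t)) = -(Complex.I • p t) - -(Complex.I • q t) := by
      rw [smul_sub]; abel
    rw [e]
    simp only [map_sub]
    exact h

theorem map (hq : IsEvolution K q) {T : Y →L[ℂ] Y} (hT : Commute K T) :
    IsEvolution K (fun t => T (q t)) :=
  of_hasDerivAt (T.continuous.comp hq.continuous) fun t => by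
    have h := (T.restrictScalars ℝ).hasFDerivAt.comp_hasDerivAt t (hq.hasDerivAt t)
    have e : ∀ y, K (T y) = T (K y) := fun y => DFunLike.congr_fun hT y
    simp only [e, ← map_smul, ← map_neg]
    exact h

theorem comp_add (hq : IsEvolution K q) (h : ℝ) : IsEvolution K (fun t => q (t + h)) :=
  of_hasDerivAt (hq.continuous.comp (continuous_add_const h)) fun t =>
    (hq.hasDerivAt (t + h)).comp_add_const t h

/-- The derivative of `⟨K q, K q⟩` is `⟨K q, -i q⟩ + ⟨-i q, K q⟩`, which cancels because `K` is
symmetric. -/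
theorem norm_map_eq (hK : IsSelfAdjoint K) (hq : IsEvolution K q) (t : ℝ) :
    ‖K (q t)‖ = ‖K (q 0)‖ := by
  have h1 : ∀ s, HasDerivAt (fun s => inner ℂ (K (q s)) (K (q s))) (0 : ℂ) s := by
    intro s
    have h := (hq.hasDerivAt s).inner ℂ (hq.hasDerivAt s)
    have e : inner ℂ (K (q s)) (-(Complex.I • q s)) + inner ℂ (-(Complex.I • q s)) (K (q s))
        = 0 := by
      rw [inner_neg_left, inner_neg_right, inner_smul_left, inner_smul_right,
        selfAdjoint_inner hK, Complex.conj_I]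
      ring
    rwa [e] at h
  have h2 := is_const_of_deriv_eq_zero (fun s => (h1 s).differentiableAt)
    (fun s => (h1 s).deriv) t 0
  simp only [inner_self_eq_norm_sq_to_K] at h2
  have h3 : ‖K (q t)‖ ^ 2 = ‖K (q 0)‖ ^ 2 := by exact_mod_cast h2
  exact (sq_eq_sq₀ (norm_nonneg _) (norm_nonneg _)).1 h3

theorem unique (hK : IsSelfAdjoint K) (hinj : Function.Injective K) (hp : IsEvolution K p)
    (hq : IsEvolution K q) (h0 : p 0 = q 0) : p = q := by
  ext t
  have h := (hp.sub hq).norm_map_eq hK t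
  simp only [h0, sub_self, map_zero, norm_zero, norm_eq_zero] at h
  exact sub_eq_zero.1 (hinj (h.trans (map_zero K).symm))

/-- `‖q s‖` is the limit of the norms of the difference quotients of `K q` at `s`. Each of these is
independent of `s`, by `norm_map_eq` for the solution `q (· + h) - q`. -/
theorem norm_eq (hK : IsSelfAdjoint K) (hq : IsEvolution K q) (t : ℝ) : ‖q t‖ = ‖q 0‖ := by
  have h1 : ∀ s, Tendsto (fun h : ℝ => ‖h⁻¹ • (K (q (s + h)) - K (q s))‖) (𝓝[≠] 0)
      (𝓝 ‖q s‖) := by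
    intro s
    have h := ((hq.hasDerivAt s).tendsto_slope_zero).norm
    rwa [norm_neg, norm_smul, Complex.norm_I, one_mul] at h
  refine tendsto_nhds_unique (h1 t) ((h1 0).congr fun h => ?_)
  have h2 := ((hq.comp_add h).sub hq).norm_map_eq hK t
  simp only [map_sub] at h2
  rw [norm_smul, norm_smul, h2]

end IsEvolution

/-! ### Existence of solutions by functional calculus -/

/-- The function `k ↦ k e^{-it/k}`. -/
def phase (t k : ℝ) : ℂ := k * Complex.exp (-(t / k : ℝ) * Complex.I)

theorem norm_phase (t k : ℝ) : ‖phase t k‖ = |k| := by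
  rw [phase, norm_mul, ← Complex.ofReal_neg, Complex.norm_exp_ofReal_mul_I, mul_one,
    Complex.norm_real, Real.norm_eq_abs]

/-- The factor `k` tames the oscillation at `k = 0`: the modulus is `|k|`. -/
theorem continuous_phase (t : ℝ) : Continuous (phase t) := by
  rw [continuous_iff_continuousAt]
  intro k
  rcases eq_or_ne k 0 with rfl | hk
  · have h0 : phase t 0 = 0 := by simp [phase]
    rw [ContinuousAt, h0, tendsto_zero_iff_norm_tendsto_zero]
    simp only [norm_phase]
    simpa using (continuous_abs (G := ℝ)).tendsto 0
  · unfold phase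
    have h1 : ContinuousAt (fun k : ℝ => t / k) k := continuousAt_const.div continuousAt_id hk
    have h2 : ContinuousAt (fun k : ℝ => ((t / k : ℝ) : ℂ)) k :=
      Complex.continuous_ofReal.continuousAt.comp h1
    exact Complex.continuous_ofReal.continuousAt.mul ((h2.neg.mul continuousAt_const).cexp)

theorem norm_exp_mul_I_sub_one_sub_le (x : ℝ) :
    ‖Complex.exp (x * Complex.I) - 1 - x * Complex.I‖ ≤ 3 * x ^ 2 := by
  have hx : ‖(x * Complex.I : ℂ)‖ = |x| := by
    rw [norm_mul, Complex.norm_I, mul_one, Complex.norm_real, Real.norm_eq_abs]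
  rcases le_total |x| 1 with h | h
  · have := Complex.norm_exp_sub_one_sub_id_le (x := x * Complex.I) (by rwa [hx])
    rw [hx, sq_abs] at this
    nlinarith [sq_nonneg x]
  · calc _ ≤ ‖Complex.exp (x * Complex.I)‖ + ‖(1 : ℂ)‖ + ‖(x * Complex.I : ℂ)‖ :=
          (norm_sub_le _ _).trans (add_le_add_left (norm_sub_le _ _) _)
      _ = 2 + |x| := by rw [hx, Complex.norm_exp_ofReal_mul_I, norm_one]; norm_num
      _ ≤ 3 * x ^ 2 := by rw [← sq_abs]; nlinarith

theorem phase_add (t h k : ℝ) :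
    phase (t + h) k = phase t k * Complex.exp ((-(h / k) : ℝ) * Complex.I) := by
  rw [phase, phase, mul_assoc, ← Complex.exp_add]
  congr 2
  push_cast
  ring

theorem norm_phase_sub_le (t h k : ℝ) : ‖phase (t + h) k - phase t k‖ ≤ |h| := by
  rw [phase_add, ← mul_sub_one, norm_mul, norm_phase, mul_comm (Complex.ofReal _)]
  rcases eq_or_ne k 0 with rfl | hk
  · simp
  refine (mul_le_mul_of_nonneg_left (Real.norm_exp_I_mul_ofReal_sub_one_le) (abs_nonneg k)).trans ?_
  rw [norm_neg, Real.norm_eq_abs, abs_div, mul_div_cancel₀ _ (abs_ne_zero.2 hk)]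

/-- A Taylor estimate uniform in `k`: the remainder `3 (h/k)²` is multiplied by `k²`, so the
singularity at `0` disappears. It passes to operators and makes `K * phaseOp K t` differentiable in
norm. -/
theorem norm_mul_phase_sub_le (t h k : ℝ) :
    ‖k * phase (t + h) k - k * phase t k - h * (-Complex.I * phase t k)‖ ≤ 3 * h ^ 2 := by
  rcases eq_or_ne k 0 with rfl | hk
  · have : phase t 0 = 0 := by simp [phase]
    rw [this]
    simp only [Complex.ofReal_zero, zero_mul, mul_zero, sub_zero, norm_zero]
    positivity
  have e : k * phase (t + h) k - k * phase t k - h * (-Complex.I * phase t k)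
      = k * phase t k * (Complex.exp ((-(h / k) : ℝ) * Complex.I) - 1
        - (-(h / k) : ℝ) * Complex.I) := by
    have hk' : (k : ℂ) ≠ 0 := by exact_mod_cast hk
    rw [phase_add]
    push_cast
    field_simp
  rw [e, norm_mul, norm_mul, norm_phase, Complex.norm_real, Real.norm_eq_abs, abs_mul_abs_self]
  refine (mul_le_mul_of_nonneg_left (norm_exp_mul_I_sub_one_sub_le _)
    (mul_self_nonneg k)).trans (le_of_eq ?_)
  field_simp

/-- The operator `K e^{-it/K}`. -/
def phaseOp (K : Y →L[ℂ] Y) (t : ℝ) : Y →L[ℂ] Y := cfc (fun w : ℂ => phase t w.re) K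

theorem continuous_phase_re (t : ℝ) : Continuous (fun w : ℂ => phase t w.re) :=
  (continuous_phase t).comp Complex.continuous_re

/-- The spectrum is real, so taking the real part changes nothing on it. -/
theorem cfc_re_eq_self {K : Y →L[ℂ] Y} (hK : IsSelfAdjoint K) :
    cfc (fun w : ℂ => (w.re : ℂ)) K = K := by
  have hn : IsStarNormal K := hK.isStarNormal
  conv_rhs => rw [← cfc_id' ℂ K]
  apply cfc_congr
  intro w hw
  have := hK.im_eq_zero_of_mem_spectrum hw
  exact Complex.ext rfl (by simpa using this.symm)

theorem phaseOp_zero {K : Y →L[ℂ] Y} (hK : IsSelfAdjoint K) : phaseOp K 0 = K := by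
  conv_rhs => rw [← cfc_re_eq_self hK]
  simp [phaseOp, phase]

theorem norm_phaseOp_sub_le {K : Y →L[ℂ] Y} (hK : IsSelfAdjoint K) (t h : ℝ) :
    ‖phaseOp K (t + h) - phaseOp K t‖ ≤ |h| := by
  have hn : IsStarNormal K := hK.isStarNormal
  rw [phaseOp, phaseOp, ← cfc_sub _ _ K (continuous_phase_re _).continuousOn
    (continuous_phase_re _).continuousOn]
  exact norm_cfc_le (abs_nonneg h) fun w _ => norm_phase_sub_le t h w.re

theorem norm_mul_phaseOp_sub_le {K : Y →L[ℂ] Y} (hK : IsSelfAdjoint K) (t h : ℝ) :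
    ‖K * phaseOp K (t + h) - K * phaseOp K t - (h : ℂ) • (-Complex.I) • phaseOp K t‖
      ≤ 3 * h ^ 2 := by
  have hn : IsStarNormal K := hK.isStarNormal
  have hc : Continuous (fun w : ℂ => (w.re : ℂ)) :=
    Complex.continuous_ofReal.comp Complex.continuous_re
  have h1 : ∀ s, K * phaseOp K s = cfc (fun w : ℂ => (w.re : ℂ) * phase s w.re) K := by
    intro s
    rw [cfc_mul _ _ K hc.continuousOn (continuous_phase_re _).continuousOn, cfc_re_eq_self hK]
    rfl
  have hc2 : Continuous (fun w : ℂ => -Complex.I * phase t w.re) :=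
    continuous_const.mul (continuous_phase_re _)
  have hc3 : Continuous (fun w : ℂ => (h : ℂ) * (-Complex.I * phase t w.re)) :=
    continuous_const.mul hc2
  have h2 : (h : ℂ) • (-Complex.I) • phaseOp K t
      = cfc (fun w : ℂ => (h : ℂ) * (-Complex.I * phase t w.re)) K := by
    rw [cfc_const_mul _ (fun w : ℂ => -Complex.I * phase t w.re) K hc2.continuousOn,
      cfc_const_mul _ (fun w : ℂ => phase t w.re) K (continuous_phase_re _).continuousOn]
    rfl
  have hc1 : ∀ s, Continuous (fun w : ℂ => (w.re : ℂ) * phase s w.re) := fun s =>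
    hc.mul (continuous_phase_re _)
  rw [h1, h1, h2, ← cfc_sub _ _ K (hc1 _).continuousOn (hc1 _).continuousOn,
    ← cfc_sub (fun w : ℂ => (w.re : ℂ) * phase (t + h) w.re - w.re * phase t w.re) _ K
      ((hc1 _).sub (hc1 _)).continuousOn hc3.continuousOn]
  exact norm_cfc_le (by positivity) fun w _ => norm_mul_phase_sub_le t h w.re

theorem isEvolution_phaseOp {K : Y →L[ℂ] Y} (hK : IsSelfAdjoint K) (z : Y) :
    IsEvolution K (fun t => phaseOp K t z) := by
  apply IsEvolution.of_hasDerivAt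
  · have : LipschitzWith 1 (phaseOp K) := LipschitzWith.of_dist_le_mul fun s t => by
      rw [dist_eq_norm, Real.dist_eq, NNReal.coe_one, one_mul]
      simpa using norm_phaseOp_sub_le hK t (s - t)
    exact this.continuous.clm_apply continuous_const
  · intro t
    rw [hasDerivAt_iff_isLittleO]
    refine Asymptotics.IsBigO.trans_isLittleO (g := fun s => (s - t) ^ 2) ?_
      (by simpa using Asymptotics.isLittleO_pow_sub_sub t one_lt_two)
    refine Asymptotics.IsBigO.of_bound (3 * ‖z‖) (Eventually.of_forall fun s => ?_)
    have h := (ContinuousLinearMap.le_opNorm (K * phaseOp K (t + (s - t)) - K * phaseOp K t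
      - ((s - t : ℝ) : ℂ) • (-Complex.I) • phaseOp K t) z).trans
      (mul_le_mul_of_nonneg_right (norm_mul_phaseOp_sub_le hK t (s - t)) (norm_nonneg z))
    rw [add_sub_cancel] at h
    rw [norm_pow, Real.norm_eq_abs, sq_abs, mul_right_comm]
    refine le_trans (le_of_eq ?_) h
    congr 1
    rw [sub_apply, sub_apply, smul_apply, smul_apply, neg_smul, Complex.coe_smul]
    rfl

/-- Existence of solutions for arbitrary initial values. -/
theorem exists_isEvolution {K : Y →L[ℂ] Y} (hK : IsSelfAdjoint K)
    (hinj : Function.Injective K) (x : Y) : ∃ q, IsEvolution K q ∧ q 0 = x := by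
  obtain ⟨w, hw, hwx⟩ := mem_closure_iff_seq_limit.1 (denseRange_of_injective hK hinj x)
  choose z hz using hw
  let p : ℕ → ℝ → Y := fun n t => phaseOp K t (z n)
  have hp : ∀ n, IsEvolution K (p n) := fun n => isEvolution_phaseOp hK (z n)
  have hp0 : ∀ n, p n 0 = w n := fun n => by
    change phaseOp K 0 (z n) = w n
    rw [phaseOp_zero hK, hz]
  -- Norm conservation for differences makes the approximating solutions Cauchy uniformly in time,
  -- so continuity and the integrated equation survive the limit.
  have hd : ∀ n m t, ‖p n t - p m t‖ = ‖w n - w m‖ := fun n m t => by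
    have := ((hp n).sub (hp m)).norm_eq hK t
    simpa only [hp0] using this
  have hcau : ∀ t, CauchySeq (fun n => p n t) := fun t => by
    rw [Metric.cauchySeq_iff]
    intro ε hε
    obtain ⟨N, hN⟩ := Metric.cauchySeq_iff.1 hwx.cauchySeq ε hε
    refine ⟨N, fun m hm n hn => ?_⟩
    have := hN m hm n hn
    rwa [dist_eq_norm, ← hd m n t, ← dist_eq_norm] at this
  choose q hq using fun t => cauchySeq_tendsto_of_complete (hcau t)
  have hq0 : q 0 = x := by
    refine tendsto_nhds_unique (hq 0) ?_
    simpa only [hp0] using hwx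
  have hbound : ∀ n t, ‖p n t - q t‖ ≤ ‖w n - x‖ := fun n t => by
    refine le_of_tendsto_of_tendsto' ((tendsto_const_nhds.sub (hq t)).norm)
      ((tendsto_const_nhds.sub hwx).norm) fun m => (hd n m t).le
  have hw0 : Tendsto (fun n => ‖w n - x‖) atTop (𝓝 0) := tendsto_iff_norm_sub_tendsto_zero.1 hwx
  have hunif : TendstoUniformly p q atTop := by
    rw [Metric.tendstoUniformly_iff]
    intro ε hε
    filter_upwards [hw0.eventually (gt_mem_nhds hε)] with n hn t
    rw [dist_comm, dist_eq_norm]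
    exact (hbound n t).trans_lt hn
  have hqc : Continuous q := hunif.continuous
    (Eventually.of_forall fun n => (hp n).continuous).frequently
  refine ⟨q, ⟨hqc, fun t => ?_⟩, hq0⟩
  have h1 : Tendsto (fun n => K (p n t - p n 0)) atTop (𝓝 (K (q t - q 0))) :=
    (K.continuous.tendsto _).comp ((hq t).sub (hq 0))
  have h2 : Tendsto (fun n => ∫ s in (0 : ℝ)..t, p n s) atTop (𝓝 (∫ s in (0 : ℝ)..t, q s)) := by
    rw [tendsto_iff_norm_sub_tendsto_zero]
    refine squeeze_zero (fun _ => norm_nonneg _) (fun n => ?_)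
      (by simpa only [zero_mul] using hw0.mul_const |t - 0|)
    rw [← intervalIntegral.integral_sub ((hp n).continuous.intervalIntegrable _ _)
      (hqc.intervalIntegrable _ _)]
    exact intervalIntegral.norm_integral_le_of_norm_le_const fun s _ => hbound n s
  refine tendsto_nhds_unique h1 (((h2.const_smul Complex.I).neg).congr fun n => ?_)
  exact ((hp n).mild t).symm

end Evolution

/-! ### Sums of orthogonal vectors -/

section OrthogonalSums

variable {Y : Type*} [NormedAddCommGroup Y] [InnerProductSpace ℂ Y]

theorem norm_sum_sq_of_orthogonal {ι : Type*} (s : Finset ι) (u : ι → Y)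
    (hu : ∀ i ∈ s, ∀ j ∈ s, i ≠ j → inner ℂ (u i) (u j) = 0) :
    ‖∑ i ∈ s, u i‖ ^ 2 = ∑ i ∈ s, ‖u i‖ ^ 2 := by
  have h : inner ℂ (∑ i ∈ s, u i) (∑ i ∈ s, u i) = ∑ i ∈ s, inner ℂ (u i) (u i) := by
    rw [sum_inner]
    refine Finset.sum_congr rfl fun i hi => ?_
    rw [inner_sum]
    exact Finset.sum_eq_single_of_mem i hi fun j hj hij => hu i hi j hj hij.symm
  simp only [inner_self_eq_norm_sq_to_K] at h
  exact_mod_cast h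

/-- By Pythagoras a termwise bound carries over with the same constant, whatever the number of
terms. This is what makes all Riemann sum errors below proportional to the mesh. -/
theorem norm_sum_le_of_orthogonal {ι : Type*} (s : Finset ι) (u v : ι → Y) {c : ℝ} (hc : 0 ≤ c)
    (hu : ∀ i ∈ s, ∀ j ∈ s, i ≠ j → inner ℂ (u i) (u j) = 0)
    (hv : ∀ i ∈ s, ∀ j ∈ s, i ≠ j → inner ℂ (v i) (v j) = 0)
    (h : ∀ i ∈ s, ‖u i‖ ≤ c * ‖v i‖) : ‖∑ i ∈ s, u i‖ ≤ c * ‖∑ i ∈ s, v i‖ := by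
  apply le_of_sq_le_sq _ (by positivity)
  rw [mul_pow, norm_sum_sq_of_orthogonal s u hu, norm_sum_sq_of_orthogonal s v hv,
    Finset.mul_sum]
  refine Finset.sum_le_sum fun i hi => ?_
  rw [← mul_pow]
  exact pow_le_pow_left₀ (norm_nonneg _) (h i hi) 2

end OrthogonalSums

/-! ### Monotone projection families and Riemann sums of the identity -/

section ProjectionFamily

variable {Y : Type*} [NormedAddCommGroup Y] [InnerProductSpace ℂ Y] [CompleteSpace Y]

/-- A monotone family of orthogonal projections. -/
structure IsProjectionFamily (E : ℝ → Y →L[ℂ] Y) : Prop where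
  projection : ∀ ω, IsStarProjection (E ω)
  mono : ∀ ω ω' : ℝ, ω ≤ ω' → (E ω).comp (E ω') = E ω

/-- The projection `E b - E a` belonging to the interval `(a, b]`. -/
def increment (E : ℝ → Y →L[ℂ] Y) (a b : ℝ) : Y →L[ℂ] Y := E b - E a

theorem increment_apply (E : ℝ → Y →L[ℂ] Y) (a b : ℝ) (z : Y) :
    increment E a b z = E b z - E a z := rfl

namespace IsProjectionFamily

variable {E : ℝ → Y →L[ℂ] Y}

theorem inner_eq (hE : IsProjectionFamily E) (a : ℝ) (x y : Y) :
    inner ℂ (E a x) y = inner ℂ x (E a y) :=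
  selfAdjoint_inner (hE.projection a).isSelfAdjoint x y

theorem apply_apply_of_le (hE : IsProjectionFamily E) {a b : ℝ} (h : a ≤ b) (z : Y) :
    E a (E b z) = E a z := DFunLike.congr_fun (hE.mono a b h) z

theorem apply_apply_of_ge (hE : IsProjectionFamily E) {a b : ℝ} (h : a ≤ b) (z : Y) :
    E b (E a z) = E a z := by
  apply ext_inner_left ℂ
  intro v
  rw [← hE.inner_eq, ← hE.inner_eq, hE.apply_apply_of_le h, hE.inner_eq]

theorem apply_comm (hE : IsProjectionFamily E) (a b : ℝ) (z : Y) :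
    E a (E b z) = E b (E a z) := by
  rcases le_total a b with h | h
  · rw [hE.apply_apply_of_le h, hE.apply_apply_of_ge h]
  · rw [hE.apply_apply_of_le h, hE.apply_apply_of_ge h]

theorem inner_increment (hE : IsProjectionFamily E) (a b : ℝ) (x y : Y) :
    inner ℂ (increment E a b x) y = inner ℂ x (increment E a b y) := by
  rw [increment_apply, increment_apply, inner_sub_left, inner_sub_right, hE.inner_eq, hE.inner_eq]

theorem increment_comm (hE : IsProjectionFamily E) (a b c d : ℝ) (z : Y) :
    increment E a b (increment E c d z) = increment E c d (increment E a b z) := by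
  simp only [increment_apply, map_sub]
  rw [hE.apply_comm b d, hE.apply_comm a d, hE.apply_comm b c, hE.apply_comm a c]
  abel

theorem increment_increment_of_subset (hE : IsProjectionFamily E) {a b c d : ℝ} (hca : c ≤ a)
    (hab : a ≤ b) (hbd : b ≤ d) (z : Y) :
    increment E c d (increment E a b z) = increment E a b z := by
  simp only [increment_apply, map_sub]
  rw [hE.apply_apply_of_ge hbd, hE.apply_apply_of_ge (hab.trans hbd),
    hE.apply_apply_of_le (hca.trans hab), hE.apply_apply_of_le hca]
  abel

theorem increment_increment_self (hE : IsProjectionFamily E) {a b : ℝ} (hab : a ≤ b) (z : Y) :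
    increment E a b (increment E a b z) = increment E a b z :=
  hE.increment_increment_of_subset le_rfl hab le_rfl z

theorem increment_increment_of_disjoint (hE : IsProjectionFamily E) {a b c d : ℝ} (hab : a ≤ b)
    (hbc : b ≤ c) (hcd : c ≤ d) (z : Y) :
    increment E a b (increment E c d z) = 0 := by
  simp only [increment_apply, map_sub]
  rw [hE.apply_apply_of_le hbc, hE.apply_apply_of_le (hbc.trans hcd),
    hE.apply_apply_of_le (hab.trans hbc), hE.apply_apply_of_le (hab.trans (hbc.trans hcd))]
  abel

theorem norm_apply_le (hE : IsProjectionFamily E) (a : ℝ) (z : Y) : ‖E a z‖ ≤ ‖z‖ := by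
  have h : ‖E a z‖ * ‖E a z‖ ≤ ‖E a z‖ * ‖z‖ := by
    have h1 : ‖E a z‖ * ‖E a z‖ = ‖(inner ℂ (E a z) z : ℂ)‖ := by
      have e : inner ℂ (E a z) z = inner ℂ (E a z) (E a z) := by
        rw [← hE.inner_eq, hE.apply_apply_of_le le_rfl]
      rw [e, inner_self_eq_norm_sq_to_K]
      simp [sq]
    rw [h1]
    exact norm_inner_le_norm _ _
  rcases (norm_nonneg (E a z)).eq_or_lt with h0 | h0
  · rw [← h0]; exact norm_nonneg z
  · exact le_of_mul_le_mul_left h h0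

theorem norm_increment_le (hE : IsProjectionFamily E) {a b : ℝ} (hab : a ≤ b) (z : Y) :
    ‖increment E a b z‖ ≤ ‖z‖ := by
  have h : increment E a b z = E b (z - E a z) := by
    rw [increment_apply, map_sub, hE.apply_apply_of_ge hab]
  have h2 : ‖z - E a z‖ ^ 2 = ‖z‖ ^ 2 - ‖E a z‖ ^ 2 := by
    have h3 : inner ℂ z (E a z) = inner ℂ (E a z) (E a z) := by
      rw [hE.inner_eq, hE.apply_apply_of_le le_rfl]
    rw [@norm_sub_sq ℂ, h3, inner_self_eq_norm_sq]
    ring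
  rw [h]
  refine (hE.norm_apply_le b _).trans (le_of_sq_le_sq ?_ (norm_nonneg z))
  rw [h2]
  nlinarith [sq_nonneg ‖E a z‖]

end IsProjectionFamily

/-- The points `x` with tags `ξ` form a tagged partition with `n` pieces of length below `δ`. -/
def IsTagged (n : ℕ) (x ξ : ℕ → ℝ) (δ : ℝ) : Prop :=
  ∀ i < n, x i ≤ ξ i ∧ ξ i ≤ x (i + 1) ∧ x (i + 1) - x i < δ

theorem IsTagged.mono {n : ℕ} {x ξ : ℕ → ℝ} {δ : ℝ} (h : IsTagged n x ξ δ) {i j : ℕ}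
    (hij : i ≤ j) (hj : j ≤ n) : x i ≤ x j := by
  induction j, hij using Nat.le_induction with
  | base => exact le_rfl
  | succ k hk ih =>
    have := h k (by omega)
    exact (ih (by omega)).trans (this.1.trans this.2.1)

theorem sum_increment (E : ℝ → Y →L[ℂ] Y) (n : ℕ) (x : ℕ → ℝ) (z : Y) :
    ∑ i ∈ Finset.range n, increment E (x i) (x (i + 1)) z = increment E (x 0) (x n) z :=
  Finset.sum_range_sub (fun i => E (x i) z) n

theorem IsProjectionFamily.inner_increment_eq_zero {E : ℝ → Y →L[ℂ] Y}
    (hE : IsProjectionFamily E) {n : ℕ} {x ξ : ℕ → ℝ} {δ : ℝ} (h : IsTagged n x ξ δ) {i j : ℕ}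
    (hi : i < n) (hj : j < n) (hij : i ≠ j) (y z : Y) :
    inner ℂ (increment E (x i) (x (i + 1)) y) (increment E (x j) (x (j + 1)) z) = 0 := by
  rw [hE.inner_increment]
  rcases hij.lt_or_gt with hlt | hlt
  · rw [hE.increment_increment_of_disjoint (h.mono (Nat.le_succ i) hi) (h.mono hlt hj.le)
      (h.mono (Nat.le_succ j) hj), inner_zero_right]
  · rw [hE.increment_comm, hE.increment_increment_of_disjoint (h.mono (Nat.le_succ j) hj)
      (h.mono hlt hi.le) (h.mono (Nat.le_succ i) hi), inner_zero_right]

/-- Every interval has tagged partitions of arbitrarily small mesh. -/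
theorem exists_isTagged {a b δ : ℝ} (hab : a ≤ b) (hδ : 0 < δ) :
    ∃ (n : ℕ) (x ξ : ℕ → ℝ), x 0 = a ∧ x n = b ∧ IsTagged n x ξ δ := by
  obtain ⟨n, hn⟩ := exists_nat_gt ((b - a) / δ)
  have hn0 : (0 : ℝ) < n := (div_nonneg (sub_nonneg.2 hab) hδ.le).trans_lt hn
  let x : ℕ → ℝ := fun i => a + i * ((b - a) / n)
  have hstep : ∀ i, x (i + 1) - x i = (b - a) / n := fun i => by
    simp only [x]; push_cast; ring
  have hstep0 : 0 ≤ (b - a) / n := div_nonneg (sub_nonneg.2 hab) hn0.le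
  refine ⟨n, x, x, by simp [x], ?_, fun i _ => ⟨le_rfl, ?_, ?_⟩⟩
  · simp only [x]; field_simp; ring
  · linarith [hstep i]
  · rw [hstep, div_lt_iff₀ hn0]
    rwa [div_lt_iff₀ hδ, mul_comm] at hn

theorem HasStieltjesIntegralOn.unique {f : ℝ → ℂ} {F : ℝ → Y} {a b : ℝ} (hab : a ≤ b) {I I' : Y}
    (h : HasStieltjesIntegralOn f F a b I) (h' : HasStieltjesIntegralOn f F a b I') : I = I' := by
  rw [← sub_eq_zero, ← norm_le_zero_iff]
  refine le_of_forall_pos_le_add fun ε hε => ?_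
  obtain ⟨δ, hδ, H⟩ := h (ε / 2) (by positivity)
  obtain ⟨δ', hδ', H'⟩ := h' (ε / 2) (by positivity)
  obtain ⟨n, x, ξ, hx0, hxn, hx⟩ := exists_isTagged hab (lt_min hδ hδ')
  have e1 := H n x ξ hx0 hxn fun i hi => ⟨(hx i hi).1, (hx i hi).2.1,
    (hx i hi).2.2.trans_le (min_le_left _ _)⟩
  have e2 := H' n x ξ hx0 hxn fun i hi => ⟨(hx i hi).1, (hx i hi).2.1,
    (hx i hi).2.2.trans_le (min_le_right _ _)⟩
  set S := ∑ i ∈ Finset.range n, f (ξ i) • (F (x (i + 1)) - F (x i))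
  have : I - I' = (S - I') - (S - I) := by abel
  rw [this]
  linarith [norm_sub_le (S - I') (S - I)]

/-- The Riemann sums of the identity. -/
def idSum (E : ℝ → Y →L[ℂ] Y) (n : ℕ) (x ξ : ℕ → ℝ) (v : Y) : Y :=
  ∑ i ∈ Finset.range n, (ξ i : ℂ) • increment E (x i) (x (i + 1)) v

/-- Two Riemann sums of the identity over intervals carrying `v` are close as soon as the tags of
overlapping pieces are. -/
theorem norm_idSum_sub_idSum_le {E : ℝ → Y →L[ℂ] Y} (hE : IsProjectionFamily E) {n m : ℕ}
    {x ξ y η : ℕ → ℝ} {δ δ' ε : ℝ} (hx : IsTagged n x ξ δ) (hy : IsTagged m y η δ') {v : Y}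
    (hxv : increment E (x 0) (x n) v = v) (hyv : increment E (y 0) (y m) v = v) (hε : 0 ≤ ε)
    (h : ∀ i < n, ∀ j < m, x i < y (j + 1) → y j < x (i + 1) → |ξ i - η j| ≤ ε) :
    ‖idSum E n x ξ v - idSum E m y η v‖ ≤ ε * ‖v‖ := by
  -- The products of increments play the role of the common refinement: they vanish for disjoint
  -- pieces, are pairwise orthogonal, and sum to `v`, so no merged partition has to be sorted.
  let w : ℕ × ℕ → Y := fun p =>
    increment E (x p.1) (x (p.1 + 1)) (increment E (y p.2) (y (p.2 + 1)) v)
  let s := Finset.range n ×ˢ Finset.range m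
  have hw : ∑ p ∈ s, w p = v := by
    simp only [s, Finset.sum_product, w, ← map_sum, sum_increment, hyv, hxv]
  have h1 : idSum E n x ξ v = ∑ p ∈ s, (ξ p.1 : ℂ) • w p := by
    simp only [s, Finset.sum_product, w, ← map_sum, sum_increment, hyv, ← Finset.smul_sum]
    rfl
  have h2 : idSum E m y η v = ∑ p ∈ s, (η p.2 : ℂ) • w p := by
    simp only [s, Finset.sum_product_right, w]
    refine Finset.sum_congr rfl fun j _ => ?_
    rw [← Finset.smul_sum, sum_increment, hE.increment_comm, hxv]
  have horth : ∀ p ∈ s, ∀ q ∈ s, p ≠ q → inner ℂ (w p) (w q) = 0 := by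
    rintro ⟨i, j⟩ hp ⟨k, l⟩ hq hpq
    simp only [s, Finset.mem_product, Finset.mem_range] at hp hq
    by_cases hik : i = k
    · have hjl : j ≠ l := fun h => hpq (by rw [hik, h])
      simp only [w]
      rw [hE.increment_comm, hE.increment_comm (x k)]
      exact hE.inner_increment_eq_zero hy hp.2 hq.2 hjl _ _
    · exact hE.inner_increment_eq_zero hx hp.1 hq.1 hik _ _
  rw [h1, h2, ← Finset.sum_sub_distrib]
  simp only [← sub_smul]
  conv_rhs => rw [← hw]
  refine norm_sum_le_of_orthogonal s _ w hε (fun p hp q hq hpq => ?_) horth fun p hp => ?_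
  · rw [inner_smul_left, inner_smul_right, horth p hp q hq hpq, mul_zero, mul_zero]
  · obtain ⟨i, j⟩ := p
    simp only [s, Finset.mem_product, Finset.mem_range] at hp
    have hxi := hx.mono (Nat.le_succ i) hp.1
    have hyj := hy.mono (Nat.le_succ j) hp.2
    by_cases h3 : x i < y (j + 1)
    · by_cases h4 : y j < x (i + 1)
      · rw [norm_smul, ← Complex.ofReal_sub, Complex.norm_real]
        exact mul_le_mul_of_nonneg_right (h i hp.1 j hp.2 h3 h4) (norm_nonneg _)
      · have : w (i, j) = 0 :=
          hE.increment_increment_of_disjoint hxi (not_lt.1 h4) hyj v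
        rw [this, smul_zero, norm_zero, mul_zero]
    · have : w (i, j) = 0 := by
        simp only [w]
        rw [hE.increment_comm]
        exact hE.increment_increment_of_disjoint hyj (not_lt.1 h3) hxi v
      rw [this, smul_zero, norm_zero, mul_zero]

theorem norm_idSum_sub_idSum_le_of_mesh {E : ℝ → Y →L[ℂ] Y} (hE : IsProjectionFamily E)
    {n m : ℕ} {x ξ y η : ℕ → ℝ} {δ δ' : ℝ} (hδ : 0 ≤ δ) (hδ' : 0 ≤ δ') (hx : IsTagged n x ξ δ)
    (hy : IsTagged m y η δ') {v : Y}
    (hxv : increment E (x 0) (x n) v = v) (hyv : increment E (y 0) (y m) v = v) :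
    ‖idSum E n x ξ v - idSum E m y η v‖ ≤ (δ + δ') * ‖v‖ := by
  refine norm_idSum_sub_idSum_le hE hx hy hxv hyv (by positivity) fun i hi j hj h1 h2 => ?_
  obtain ⟨a1, a2, a3⟩ := hx i hi
  obtain ⟨b1, b2, b3⟩ := hy j hj
  rw [abs_le]
  constructor <;> linarith

/-- The identity is integrable with respect to `E v` if `v` is carried by a bounded interval. -/
theorem exists_integral_id {E : ℝ → Y →L[ℂ] Y} (hE : IsProjectionFamily E) {a b : ℝ}
    (hab : a ≤ b) {v : Y} (hv : increment E a b v = v) :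
    ∃ I : Y, (∀ A B, A ≤ a → b ≤ B →
      HasStieltjesIntegralOn (fun ω : ℝ => (ω : ℂ)) (fun ω => E ω v) A B I) ∧
      ∀ ξ, a ≤ ξ → ξ ≤ b → ‖I - (ξ : ℂ) • v‖ ≤ (b - a) * ‖v‖ := by
  have hδ : ∀ k : ℕ, (0 : ℝ) < 1 / (k + 1) := fun k => Nat.one_div_pos_of_nat
  have hδ0 : Tendsto (fun k : ℕ => 1 / ((k : ℝ) + 1)) atTop (𝓝 0) :=
    tendsto_one_div_add_atTop_nhds_zero_nat
  choose n x ξ hx0 hxn hx using fun k => exists_isTagged hab (hδ k)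
  have hxv : ∀ k, increment E (x k 0) (x k (n k)) v = v := fun k => by rw [hx0, hxn, hv]
  let S : ℕ → Y := fun k => idSum E (n k) (x k) (ξ k) v
  have hS : ∀ k l, ‖S k - S l‖ ≤ (1 / ((k : ℝ) + 1) + 1 / ((l : ℝ) + 1)) * ‖v‖ := fun k l =>
    norm_idSum_sub_idSum_le_of_mesh hE (hδ k).le (hδ l).le (hx k) (hx l) (hxv k) (hxv l)
  have hcau : CauchySeq S := by
    have hb : Tendsto (fun k : ℕ => 2 * (1 / ((k : ℝ) + 1)) * ‖v‖) atTop (𝓝 0) := by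
      simpa using (hδ0.const_mul 2).mul_const ‖v‖
    refine cauchySeq_of_le_tendsto_0 _ (fun k l N hk hl => ?_) hb
    rw [dist_eq_norm]
    refine (hS k l).trans (mul_le_mul_of_nonneg_right ?_ (norm_nonneg v))
    have h1 : 1 / ((k : ℝ) + 1) ≤ 1 / ((N : ℝ) + 1) := Nat.one_div_le_one_div hk
    have h2 : 1 / ((l : ℝ) + 1) ≤ 1 / ((N : ℝ) + 1) := Nat.one_div_le_one_div hl
    linarith
  obtain ⟨I, hI⟩ := cauchySeq_tendsto_of_complete hcau
  refine ⟨I, fun A B hA hB ε hε => ?_, fun ζ hζa hζb => ?_⟩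
  · have hv1 : 0 < ‖v‖ + 1 := by positivity
    refine ⟨ε / (2 * (‖v‖ + 1)), by positivity, fun m y η hy0 hym hy => ?_⟩
    have hyv : increment E (y 0) (y m) v = v := by
      rw [hy0, hym, ← hv]
      exact hE.increment_increment_of_subset hA hab hB v
    have h1 : ∀ k, ‖idSum E m y η v - S k‖
        ≤ (ε / (2 * (‖v‖ + 1)) + 1 / ((k : ℝ) + 1)) * ‖v‖ := fun k =>
      norm_idSum_sub_idSum_le_of_mesh hE (by positivity) (hδ k).le hy (hx k) hyv (hxv k)
    have h2 := le_of_tendsto_of_tendsto' ((tendsto_const_nhds.sub hI).norm)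
      ((tendsto_const_nhds.add hδ0).mul_const ‖v‖) h1
    refine h2.trans_lt ?_
    rw [add_zero, div_mul_eq_mul_div, div_lt_iff₀ (by positivity)]
    nlinarith [norm_nonneg v]
  -- Comparison with the one-piece partition tagged by `ζ`. Its mesh bound `b - a + 1` only meets
  -- the strict inequality; the tag estimate over overlapping pieces loses just `b - a` plus the
  -- other mesh.
  · let y : ℕ → ℝ := fun i => if i = 0 then a else b
    have hy : IsTagged 1 y (fun _ => ζ) (b - a + 1) := by
      intro i hi
      obtain rfl : i = 0 := by omega
      simp only [y, if_true, zero_add, one_ne_zero, if_false]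
      exact ⟨hζa, hζb, by linarith⟩
    have hyv : increment E (y 0) (y 1) v = v := hv
    have hsum : idSum E 1 y (fun _ => ζ) v = (ζ : ℂ) • v := by
      rw [idSum, Finset.sum_range_one]
      exact congrArg _ hyv
    have h1 : ∀ k, ‖S k - (ζ : ℂ) • v‖ ≤ (1 / ((k : ℝ) + 1) + (b - a)) * ‖v‖ := fun k => by
      rw [← hsum]
      have hd := hδ k
      refine norm_idSum_sub_idSum_le hE (hx k) hy (hxv k) hyv (by linarith) ?_
      intro i hi j hj h1 h2
      obtain rfl : j = 0 := by omega
      simp only [y, if_true, zero_add, one_ne_zero, if_false] at h1 h2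
      obtain ⟨a1, a2, a3⟩ := hx k i hi
      rw [abs_le]
      constructor <;> linarith
    have h2 := le_of_tendsto_of_tendsto' ((hI.sub_const _).norm)
      ((hδ0.add_const (b - a)).mul_const ‖v‖) h1
    rwa [zero_add] at h2

end ProjectionFamily

/-! ### The spectral family of `K⁻¹` from continuous functional calculus -/

section

variable {Y : Type*} [NormedAddCommGroup Y] [InnerProductSpace ℂ Y] [CompleteSpace Y]

/-- `E` is the family of spectral projections of `K⁻¹`, characterized through the bounded
operator `K`. -/
structure IsSpectralFamily (K : Y →L[ℂ] Y) (E : ℝ → Y →L[ℂ] Y) : Prop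
    extends IsProjectionFamily E where
  right_continuous : ∀ (ω : ℝ) (z : Y), Tendsto (fun μ => E μ z) (𝓝[>] ω) (𝓝 (E ω z))
  tendsto_atBot : ∀ z : Y, Tendsto (fun ω => E ω z) atBot (𝓝 0)
  tendsto_atTop : ∀ z : Y, Tendsto (fun ω => E ω z) atTop (𝓝 z)
  commute_op : ∀ ω, Commute K (E ω)
  norm_sub_smul_le : ∀ (a b ξ : ℝ) (v : Y), a ≤ ξ → ξ ≤ b → increment E a b v = v →
    ‖v - (ξ : ℂ) • K v‖ ≤ (b - a) * ‖K v‖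

section Projections

/-- Orthogonal complements turn the decreasing family into an increasing one, for which the
projections converge to that onto the closed union. -/
theorem tendsto_starProjection_iInf {ι : Type*} [Preorder ι] [IsDirectedOrder ι]
    (N : ι → Submodule ℂ Y) [∀ i, (N i).HasOrthogonalProjection]
    [(⨅ i, N i).HasOrthogonalProjection] (hN : Antitone N) (z : Y) :
    Tendsto (fun i => (N i).starProjection z) atTop (𝓝 ((⨅ i, N i).starProjection z)) := by
  have hmono : Monotone fun i => (N i)ᗮ := fun i j hij => Submodule.orthogonal_le (hN hij)
  have h := Submodule.starProjection_tendsto_closure_iSup (fun i => (N i)ᗮ) hmono z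
  have e : (⨆ i, (N i)ᗮ).topologicalClosure = (⨅ i, N i)ᗮ := by
    rw [← Submodule.orthogonal_orthogonal_eq_closure, ← Submodule.iInf_orthogonal]
    simp only [Submodule.orthogonal_orthogonal]
  have h1 : ∀ (U : Submodule ℂ Y) [U.HasOrthogonalProjection],
      U.starProjection z = z - Uᗮ.starProjection z := fun U _ => by
    rw [Submodule.starProjection_orthogonal_val, sub_sub_cancel]
  have h2 : (⨆ i, (N i)ᗮ).topologicalClosure.starProjection z
      = (⨅ i, N i)ᗮ.starProjection z := by
    simp only [e]
  rw [h2] at h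
  rw [h1 (⨅ i, N i)]
  exact (h.const_sub z).congr fun i => (h1 (N i)).symm

end Projections

section Calculus

/-- The operator `h(K)² - g(K)²` is nonnegative, and its quadratic form is the difference of the
squared norms. Scalar inequalities thereby become estimates on vectors. -/
theorem norm_cfc_apply_le (K : Y →L[ℂ] Y) {g h : ℝ → ℝ}
    (hg : Continuous g) (hh : Continuous h) (hgh : ∀ k, |g k| ≤ |h k|) (x : Y) :
    ‖cfc g K x‖ ≤ ‖cfc h K x‖ := by
  have h0 : 0 ≤ cfc (fun k => h k * h k - g k * g k) K :=
    cfc_nonneg fun k _ => by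
      rw [sub_nonneg, ← abs_mul_abs_self (g k), ← abs_mul_abs_self (h k)]
      exact mul_self_le_mul_self (abs_nonneg _) (hgh k)
  rw [cfc_sub (fun k => h k * h k) (fun k => g k * g k) K (hh.mul hh).continuousOn
    (hg.mul hg).continuousOn, cfc_mul h h K hh.continuousOn hh.continuousOn,
    cfc_mul g g K hg.continuousOn hg.continuousOn] at h0
  have h1 := ((ContinuousLinearMap.nonneg_iff_isPositive _).1 h0).2 x
  have h2 : ∀ f : ℝ → ℝ, (inner ℂ ((cfc f K * cfc f K) x) x).re = ‖cfc f K x‖ ^ 2 := by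
    intro f
    have hf : IsSelfAdjoint (cfc f K) := cfc_predicate f K
    change (inner ℂ (cfc f K (cfc f K x)) x).re = _
    rw [selfAdjoint_inner hf, inner_self_eq_norm_sq_to_K]
    norm_cast
  rw [ContinuousLinearMap.reApplyInnerSelf_apply, sub_apply, inner_sub_left,
    map_sub] at h1
  change 0 ≤ (inner ℂ _ _).re - (inner ℂ _ _).re at h1
  rw [h2, h2, sub_nonneg] at h1
  exact le_of_sq_le_sq h1 (norm_nonneg _)

/-- `k ↦ (k - ω k²)⁺`. For `k ≠ 0` it vanishes exactly when `1 / k ≤ ω`. -/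
def upperFun (ω k : ℝ) : ℝ := max (k - ω * k ^ 2) 0

/-- `k ↦ (k - ω k²)⁻`. -/
def lowerFun (ω k : ℝ) : ℝ := max (ω * k ^ 2 - k) 0

theorem continuous_upperFun (ω : ℝ) : Continuous (upperFun ω) := by
  unfold upperFun; fun_prop

theorem continuous_lowerFun (ω : ℝ) : Continuous (lowerFun ω) := by
  unfold lowerFun; fun_prop

theorem upperFun_nonneg (ω k : ℝ) : 0 ≤ upperFun ω k := le_max_right _ _

theorem lowerFun_nonneg (ω k : ℝ) : 0 ≤ lowerFun ω k := le_max_right _ _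

theorem upperFun_mul_lowerFun (ω k : ℝ) : upperFun ω k * lowerFun ω k = 0 := by
  rcases le_total (k - ω * k ^ 2) 0 with h | h
  · rw [upperFun, max_eq_right h, zero_mul]
  · rw [lowerFun, max_eq_right (by linarith), mul_zero]

variable (K : Y →L[ℂ] Y)

/-- The spectral subspace of `K⁻¹` belonging to `(-∞, ω]`. -/
def spectralSubspace (ω : ℝ) : Submodule ℂ Y :=
  LinearMap.ker ((cfc (upperFun ω) K : Y →L[ℂ] Y) : Y →ₗ[ℂ] Y)

variable {K}

theorem mem_spectralSubspace {ω : ℝ} {x : Y} :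
    x ∈ spectralSubspace K ω ↔ cfc (upperFun ω) K x = 0 := LinearMap.mem_ker

theorem isClosed_spectralSubspace (ω : ℝ) : IsClosed (spectralSubspace K ω : Set Y) :=
  ContinuousLinearMap.isClosed_ker (cfc (upperFun ω) K)

instance (ω : ℝ) : (spectralSubspace K ω).HasOrthogonalProjection :=
  haveI : CompleteSpace (spectralSubspace K ω) := (isClosed_spectralSubspace ω).completeSpace_coe
  inferInstance

theorem spectralSubspace_mono : Monotone (spectralSubspace K) := by
  intro a b hab x hx
  rw [mem_spectralSubspace] at hx ⊢
  rw [← norm_le_zero_iff]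
  have h := norm_cfc_apply_le K (continuous_upperFun b) (continuous_upperFun a) (fun k => by
    rw [abs_of_nonneg (upperFun_nonneg _ _), abs_of_nonneg (upperFun_nonneg _ _)]
    exact max_le_max_right _ (by nlinarith [sq_nonneg k])) x
  rwa [hx, norm_zero] at h

theorem cfc_sq_apply (hK : IsSelfAdjoint K) (c : ℝ) (x : Y) :
    cfc (fun k : ℝ => c * k ^ 2) K x = (c : ℂ) • K (K x) := by
  rw [cfc_const_mul c (fun k : ℝ => k ^ 2) K (by fun_prop), cfc_pow_id (R := ℝ) K 2, sq]
  exact (Complex.coe_smul c (K (K x))).symm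

theorem cfc_self_apply (hK : IsSelfAdjoint K) (x : Y) : cfc (fun k : ℝ => k) K x = K x := by
  rw [cfc_id' ℝ K]

theorem cfc_add_apply (f g : ℝ → ℝ) (hf : Continuous f) (hg : Continuous g) (x : Y) :
    cfc (fun k => f k + g k) K x = cfc f K x + cfc g K x := by
  rw [cfc_add K f g hf.continuousOn hg.continuousOn]
  rfl

/-- Since the product of the two functions is zero, the range of `lowerFun ω` of `K` lies in the
spectral subspace; selfadjointness then annihilates the orthogonal complement. -/
theorem cfc_lowerFun_eq_zero {ω : ℝ} {x : Y}
    (hx : x ∈ (spectralSubspace K ω)ᗮ) : cfc (lowerFun ω) K x = 0 := by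
  apply ext_inner_left ℂ
  intro y
  have hs : IsSelfAdjoint (cfc (lowerFun ω) K) := cfc_predicate _ _
  rw [inner_zero_right, ← selfAdjoint_inner hs]
  refine (Submodule.mem_orthogonal _ _).1 hx _ (mem_spectralSubspace.2 ?_)
  change (cfc (upperFun ω) K * cfc (lowerFun ω) K) y = 0
  rw [← cfc_mul _ _ K (continuous_upperFun ω).continuousOn (continuous_lowerFun ω).continuousOn]
  simp only [upperFun_mul_lowerFun]
  rw [cfc_const_zero]
  rfl

theorem eq_zero_of_forall_norm_le (hinj : Function.Injective K) {x : Y}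
    (h : ∀ m : ℕ, ‖((m : ℝ) : ℂ) • K (K x)‖ ≤ ‖K x‖) : x = 0 := by
  have h1 : K (K x) = 0 := by
    by_contra hne
    have hpos : 0 < ‖K (K x)‖ := norm_pos_iff.2 hne
    obtain ⟨m, hm⟩ := exists_nat_gt (‖K x‖ / ‖K (K x)‖)
    have h2 := h m
    rw [norm_smul, Complex.norm_real, Real.norm_natCast] at h2
    rw [div_lt_iff₀ hpos] at hm
    linarith
  apply hinj
  apply hinj
  rw [h1, map_zero, map_zero]

/-- At `ω = -m` one has `m k² ≤ upperFun (-m) k - k`, and the first term kills `x`. Hence `m ‖K² x‖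
≤ ‖K x‖` for all `m`, which forces `x = 0` by injectivity. The next lemma is the mirror image with
`lowerFun m`. -/
theorem iInf_spectralSubspace (hK : IsSelfAdjoint K) (hinj : Function.Injective K) :
    ⨅ ω, spectralSubspace K ω = ⊥ := by
  rw [Submodule.eq_bot_iff]
  intro x hx
  rw [Submodule.mem_iInf] at hx
  refine eq_zero_of_forall_norm_le hinj fun m => ?_
  have h := norm_cfc_apply_le K (g := fun k => (m : ℝ) * k ^ 2)
    (h := fun k => upperFun (-m) k + -1 * k) (by fun_prop)
    ((continuous_upperFun _).add (by fun_prop)) (fun k => by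
      have h1 : 0 ≤ (m : ℝ) * k ^ 2 := by positivity
      have h2 : k - -m * k ^ 2 ≤ upperFun (-m) k := le_max_left _ _
      exact abs_le_abs_of_nonneg h1 (by linarith)) x
  rw [cfc_sq_apply hK, cfc_add_apply _ _ (continuous_upperFun _) (by fun_prop),
    mem_spectralSubspace.1 (hx _), zero_add, cfc_const_mul (-1) (fun k : ℝ => k) K (by fun_prop),
    cfc_id' ℝ K] at h
  simpa using h

theorem iInf_orthogonal_spectralSubspace (hK : IsSelfAdjoint K) (hinj : Function.Injective K) :
    ⨅ ω, (spectralSubspace K ω)ᗮ = ⊥ := by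
  rw [Submodule.eq_bot_iff]
  intro x hx
  rw [Submodule.mem_iInf] at hx
  refine eq_zero_of_forall_norm_le hinj fun m => ?_
  have h := norm_cfc_apply_le K (g := fun k => (m : ℝ) * k ^ 2)
    (h := fun k => lowerFun m k + k) (by fun_prop)
    ((continuous_lowerFun _).add (by fun_prop)) (fun k => by
      have h1 : 0 ≤ (m : ℝ) * k ^ 2 := by positivity
      have h2 : m * k ^ 2 - k ≤ lowerFun m k := le_max_left _ _
      exact abs_le_abs_of_nonneg h1 (by linarith)) x
  rwa [cfc_sq_apply hK, cfc_add_apply _ (fun k => k) (continuous_lowerFun _) continuous_id,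
    cfc_lowerFun_eq_zero (hx _), zero_add, cfc_self_apply hK] at h

/-- Right continuity comes from `upperFun ω k ≤ upperFun (ω + δ) k + δ k²`: if the first term kills
`x`, the error is `δ ‖K² x‖`. -/
theorem iInf_spectralSubspace_Ioi (hK : IsSelfAdjoint K) (ω : ℝ) :
    ⨅ μ : Set.Ioi ω, spectralSubspace K μ = spectralSubspace K ω := by
  apply le_antisymm
  · intro x hx
    rw [Submodule.mem_iInf] at hx
    rw [mem_spectralSubspace, ← norm_le_zero_iff]
    refine le_of_forall_pos_le_add fun ε hε => ?_
    set δ := ε / (‖K (K x)‖ + 1) with hδ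
    have hδ0 : 0 < δ := by positivity
    have h := norm_cfc_apply_le K (g := upperFun ω)
      (h := fun k => upperFun (ω + δ) k + δ * k ^ 2) (continuous_upperFun _)
      ((continuous_upperFun _).add (by fun_prop)) (fun k => by
        refine abs_le_abs_of_nonneg (upperFun_nonneg _ _) (max_le ?_ ?_)
        · have h2 : k - (ω + δ) * k ^ 2 ≤ upperFun (ω + δ) k := le_max_left _ _
          linarith
        · have := upperFun_nonneg (ω + δ) k
          positivity) x
    rw [cfc_add_apply _ _ (continuous_upperFun _) (by fun_prop),
      mem_spectralSubspace.1 (hx ⟨ω + δ, by simpa using hδ0⟩), zero_add, cfc_sq_apply hK,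
      norm_smul, Complex.norm_real, Real.norm_of_nonneg hδ0.le] at h
    refine h.trans ?_
    rw [zero_add, hδ, div_mul_eq_mul_div, div_le_iff₀ (by positivity)]
    nlinarith [norm_nonneg (K (K x))]
  · exact le_iInf fun μ => spectralSubspace_mono (le_of_lt μ.2)

/-- A closed subspace that is invariant under a selfadjoint operator reduces it. -/
theorem commute_starProjection (hK : IsSelfAdjoint K) (U : Submodule ℂ Y)
    [U.HasOrthogonalProjection] (hU : ∀ x ∈ U, K x ∈ U) : Commute K U.starProjection := by
  have hP : ∀ x y, inner ℂ (U.starProjection x) y = inner ℂ x (U.starProjection y) :=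
    selfAdjoint_inner (isStarProjection_starProjection (U := U)).isSelfAdjoint
  have h1 : ∀ x, U.starProjection (K (U.starProjection x)) = K (U.starProjection x) := fun x =>
    Submodule.starProjection_eq_self_iff.2 (hU _ (Submodule.starProjection_apply_mem U x))
  ext x
  change K (U.starProjection x) = U.starProjection (K x)
  apply ext_inner_left ℂ
  intro y
  rw [← h1, ← hP, ← selfAdjoint_inner hK, ← hP, h1, selfAdjoint_inner hK, hP]

theorem exists_isSpectralFamily (hK : IsSelfAdjoint K) (hinj : Function.Injective K) :
    ∃ E, IsSpectralFamily K E := by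
  have hmono := spectralSubspace_mono (K := K)
  have hcomm : ∀ ω, Commute K (spectralSubspace K ω).starProjection := fun ω => by
    apply commute_starProjection hK
    intro x hx
    rw [mem_spectralSubspace] at hx ⊢
    have h1 : Commute (cfc (upperFun ω) K) K := by
      simpa only [cfc_id' ℝ K] using cfc_commute_cfc (upperFun ω) (fun k : ℝ => k) K
    have h2 : cfc (upperFun ω) K (K x) = K (cfc (upperFun ω) K x) := DFunLike.congr_fun h1 x
    rw [h2, hx, map_zero]
  refine ⟨fun ω => (spectralSubspace K ω).starProjection,
    { projection := fun ω => isStarProjection_starProjection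
      mono := fun a b hab => Submodule.starProjection_comp_starProjection_of_le (hmono hab)
      right_continuous := fun ω z => ?_
      tendsto_atBot := fun z => ?_
      tendsto_atTop := fun z => ?_
      commute_op := hcomm
      norm_sub_smul_le := fun a b ξ v ha hb hv => ?_ }⟩
  -- With the order reversed, approaching `ω` from the right is a limit at infinity along an
  -- antitone family.
  · let N : (Set.Ioi ω)ᵒᵈ → Submodule ℂ Y := fun μ => spectralSubspace K (OrderDual.ofDual μ).1
    have hN : ⨅ i, N i = spectralSubspace K ω := iInf_spectralSubspace_Ioi hK ω
    have : (⨅ i, N i).HasOrthogonalProjection := by rw [hN]; infer_instance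
    have h := tendsto_starProjection_iInf N (fun i j hij => hmono hij) z
    simp only [hN] at h
    rw [← map_coe_Ioi_atBot ω, tendsto_map'_iff]
    exact h
  · let N : ℝᵒᵈ → Submodule ℂ Y := fun μ => spectralSubspace K (OrderDual.ofDual μ)
    have hN : ⨅ i, N i = ⊥ := iInf_spectralSubspace hK hinj
    have : (⨅ i, N i).HasOrthogonalProjection := by rw [hN]; infer_instance
    have h := tendsto_starProjection_iInf N (fun i j hij => hmono hij) z
    simp only [hN, Submodule.starProjection_bot, zero_apply] at h
    exact h
  · refine Submodule.starProjection_tendsto_self _ hmono z ?_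
    rw [← Submodule.orthogonal_orthogonal_eq_closure, ← Submodule.iInf_orthogonal,
      iInf_orthogonal_spectralSubspace hK hinj, Submodule.bot_orthogonal_eq_top]
  · set E := fun ω => (spectralSubspace K ω).starProjection with hE
    have hab : a ≤ b := ha.trans hb
    have hv' : E b v - E a v = v := hv
    have hEE : ∀ y, E a (E b y) = E a y := fun y => DFunLike.congr_fun
      (Submodule.starProjection_comp_starProjection_of_le (hmono hab)) y
    -- The calculus functions involve `k` and `k²`, so they give the estimate only after one extra
    -- application of `K`. It is removed below by approximating `v` by increments of vectors in the
    -- dense range of `K`.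
    have hbot : ∀ w, increment E a b w = w → ‖K w - (ξ : ℂ) • K (K w)‖ ≤ (b - a) * ‖K (K w)‖ := by
      intro w hw
      have hw' : E b w - E a w = w := hw
      have hwb : w ∈ spectralSubspace K b := by
        rw [← hw']
        exact Submodule.sub_mem _ (Submodule.starProjection_apply_mem _ _)
          (hmono hab (Submodule.starProjection_apply_mem _ _))
      have hwa : w ∈ (spectralSubspace K a)ᗮ := by
        rw [← Submodule.starProjection_apply_eq_zero_iff]
        change E a w = 0
        rw [← hw', map_sub, hEE, sub_eq_zero]
        exact (DFunLike.congr_fun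
          (Submodule.starProjection_comp_starProjection_of_le
            (le_refl (spectralSubspace K a))) w).symm
      -- Pointwise, `|k - ξ k²|` is at most `(b - a) k²` plus the two cut-off functions, both of
      -- which annihilate `w`.
      have h := norm_cfc_apply_le K (g := fun k => k + -ξ * k ^ 2)
        (h := fun k => (upperFun b k + lowerFun a k) + (b - a) * k ^ 2) (by fun_prop)
        (((continuous_upperFun _).add (continuous_lowerFun _)).add (by fun_prop)) (fun k => by
          have h1 : k - b * k ^ 2 ≤ upperFun b k := le_max_left _ _
          have h2 : a * k ^ 2 - k ≤ lowerFun a k := le_max_left _ _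
          have h3 := upperFun_nonneg b k
          have h4 := lowerFun_nonneg a k
          have h5 : ξ * k ^ 2 ≤ b * k ^ 2 := mul_le_mul_of_nonneg_right hb (sq_nonneg k)
          have h6 : a * k ^ 2 ≤ ξ * k ^ 2 := mul_le_mul_of_nonneg_right ha (sq_nonneg k)
          refine le_trans (abs_le.2 ⟨?_, ?_⟩) (le_abs_self _) <;> linarith) w
      rw [cfc_add_apply (fun k => upperFun b k + lowerFun a k) (fun k => (b - a) * k ^ 2)
          ((continuous_upperFun _).add (continuous_lowerFun _)) (by fun_prop),
        cfc_add_apply _ _ (continuous_upperFun _) (continuous_lowerFun _),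
        mem_spectralSubspace.1 hwb, cfc_lowerFun_eq_zero hwa, zero_add, zero_add,
        cfc_sq_apply hK, cfc_add_apply (fun k => k) (fun k => -ξ * k ^ 2) continuous_id
          (by fun_prop), cfc_self_apply hK,
        cfc_sq_apply hK, norm_smul, Complex.norm_real, Real.norm_of_nonneg (sub_nonneg.2 hab)] at h
      simpa [sub_eq_add_neg] using h
    obtain ⟨u, hu, hut⟩ := mem_closure_iff_seq_limit.1 (denseRange_of_injective hK hinj v)
    choose w hw using hu
    have hcE : Commute K (increment E a b) := (hcomm b).sub_right (hcomm a)
    have hKw : ∀ n, K (increment E a b (w n)) = increment E a b (u n) := fun n => by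
      rw [← hw]
      exact DFunLike.congr_fun hcE (w n)
    have hlim : Tendsto (fun n => increment E a b (u n)) atTop (𝓝 v) := by
      have := ((increment E a b).continuous.tendsto v).comp hut
      rwa [hv] at this
    have hidem : ∀ n, increment E a b (increment E a b (w n)) = increment E a b (w n) := fun n =>
      IsProjectionFamily.increment_increment_self
        ⟨fun ω => isStarProjection_starProjection,
          fun a b hab => Submodule.starProjection_comp_starProjection_of_le (hmono hab)⟩ hab _
    refine le_of_tendsto_of_tendsto'
      ((hlim.sub (((K.continuous.tendsto v).comp hlim).const_smul (ξ : ℂ))).norm)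
      ((((K.continuous.tendsto v).comp hlim).norm).const_mul (b - a)) fun n => ?_
    have := hbot _ (hidem n)
    rwa [hKw] at this

end Calculus

end

/-! ### From spectral families to spectral resolutions -/

section

variable {Y : Type*} [NormedAddCommGroup Y] [InnerProductSpace ℂ Y] [CompleteSpace Y]

theorem tendsto_increment {E : ℝ → Y →L[ℂ] Y} {z : Y}
    (h0 : Tendsto (fun ω => E ω z) atBot (𝓝 0)) (h1 : Tendsto (fun ω => E ω z) atTop (𝓝 z)) :
    Tendsto (fun p : ℝ × ℝ => increment E p.1 p.2 z) (atBot ×ˢ atTop) (𝓝 z) := by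
  have h := (h1.comp tendsto_snd).sub (h0.comp (tendsto_fst (g := (atTop : Filter ℝ))))
  rw [sub_zero] at h
  exact h

theorem eventually_le_atBot_prod_atTop :
    ∀ᶠ p : ℝ × ℝ in atBot ×ˢ atTop, p.1 ≤ p.2 := by
  filter_upwards [(eventually_le_atBot (0 : ℝ)).prod_mk (eventually_ge_atTop (0 : ℝ))] with p hp
  exact hp.1.trans hp.2

namespace IsSpectralFamily

variable {K : Y →L[ℂ] Y} {E : ℝ → Y →L[ℂ] Y}

theorem commute_increment (hE : IsSpectralFamily K E) (a b : ℝ) : Commute K (increment E a b) :=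
  (hE.commute_op b).sub_right (hE.commute_op a)

theorem map_increment (hE : IsSpectralFamily K E) (a b : ℝ) (z : Y) :
    K (increment E a b z) = increment E a b (K z) :=
  DFunLike.congr_fun (hE.commute_increment a b) z

/-- Boundedness of `H` on a bounded spectral interval, stated as a lower bound for `K`; obtained
from the tag `ξ = a`. -/
theorem norm_le (hE : IsSpectralFamily K E) {a b : ℝ} (hab : a ≤ b) {v : Y}
    (hv : increment E a b v = v) : ‖v‖ ≤ (b - a + |a|) * ‖K v‖ := by
  have h := hE.norm_sub_smul_le a b a v le_rfl hab hv
  have h2 : ‖v‖ ≤ ‖v - (a : ℂ) • K v‖ + ‖(a : ℂ) • K v‖ := by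
    simpa using norm_add_le (v - (a : ℂ) • K v) ((a : ℂ) • K v)
  rw [norm_smul, Complex.norm_real, Real.norm_eq_abs] at h2
  linarith

/-- On the range of the increment `K` is bounded below and has dense range, hence is onto: preimages
of an approximating sequence are Cauchy. -/
theorem exists_map_eq_increment (hE : IsSpectralFamily K E) (hK : IsSelfAdjoint K)
    (hinj : Function.Injective K) {a b : ℝ} (hab : a ≤ b) (z : Y) :
    ∃ w, increment E a b w = w ∧ K w = increment E a b z := by
  obtain ⟨u, hu, hut⟩ := mem_closure_iff_seq_limit.1 (denseRange_of_injective hK hinj z)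
  choose y hy using hu
  have hKw : ∀ n, K (increment E a b (y n)) = increment E a b (u n) := fun n => by
    rw [hE.map_increment, hy]
  have hcau : CauchySeq fun n => increment E a b (y n) := by
    have hc : 0 < b - a + |a| + 1 := by
      have := abs_nonneg a
      linarith
    rw [Metric.cauchySeq_iff]
    intro ε hε
    obtain ⟨N, hN⟩ := Metric.cauchySeq_iff.1 hut.cauchySeq (ε / (b - a + |a| + 1)) (by positivity)
    refine ⟨N, fun m hm n hn => ?_⟩
    have h1 := hN m hm n hn
    rw [dist_eq_norm] at h1 ⊢
    rw [← map_sub]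
    refine (hE.norm_le hab (hE.increment_increment_self hab _)).trans_lt ?_
    rw [hE.map_increment, map_sub K, hy, hy]
    have h2 := hE.norm_increment_le hab (u m - u n)
    rw [lt_div_iff₀ hc] at h1
    have h3 : 0 ≤ b - a + |a| := by linarith [abs_nonneg a]
    nlinarith [norm_nonneg (increment E a b (u m - u n))]
  obtain ⟨w, hw⟩ := cauchySeq_tendsto_of_complete hcau
  refine ⟨w, tendsto_nhds_unique (((increment E a b).continuous.tendsto w).comp hw) ?_,
    tendsto_nhds_unique ((K.continuous.tendsto w).comp hw) ?_⟩
  · exact hw.congr fun n => (hE.increment_increment_self hab _).symm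
  · exact (((increment E a b).continuous.tendsto z).comp hut).congr fun n => (hKw n).symm

/-- Piece by piece, `ξ_i K w_i` differs from `w_i` by at most the mesh times `‖K w_i‖`, and the
pieces are orthogonal. -/
theorem hasStieltjesIntegralOn_id (hE : IsSpectralFamily K E) {a b : ℝ}
    {w z : Y} (hw : increment E a b w = w) (hKw : K w = increment E a b z) :
    HasStieltjesIntegralOn (fun ω : ℝ => (ω : ℂ)) (fun ω => E ω z) a b w := by
  intro ε hε
  have hc : 0 < ‖K w‖ + 1 := by positivity
  refine ⟨ε / (‖K w‖ + 1), by positivity, fun n x ξ hx0 hxn hx => ?_⟩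
  set δ := ε / (‖K w‖ + 1)
  have hx' : IsTagged n x ξ δ := hx
  have hinc : ∀ i < n, increment E (x i) (x (i + 1)) z = K (increment E (x i) (x (i + 1)) w) := by
    intro i hi
    rw [hE.map_increment, hKw, hE.increment_comm, ← hx0, ← hxn]
    exact (hE.increment_increment_of_subset (hx'.mono (Nat.zero_le i) hi.le)
      (hx'.mono (Nat.le_succ i) hi) (hx'.mono (Nat.succ_le_of_lt hi) le_rfl) z).symm
  have hsum : ∑ i ∈ Finset.range n, increment E (x i) (x (i + 1)) w = w := by
    rw [sum_increment, hx0, hxn, hw]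
  have hdiff : (∑ i ∈ Finset.range n, (ξ i : ℂ) • (E (x (i + 1)) z - E (x i) z)) - w
      = ∑ i ∈ Finset.range n, ((ξ i : ℂ) • K (increment E (x i) (x (i + 1)) w)
        - increment E (x i) (x (i + 1)) w) := by
    rw [Finset.sum_sub_distrib, hsum]
    congr 1
    refine Finset.sum_congr rfl fun i hi => ?_
    rw [← hinc i (Finset.mem_range.1 hi)]
    rfl
  rw [hdiff]
  have hle := norm_sum_le_of_orthogonal (Finset.range n)
    (fun i => (ξ i : ℂ) • K (increment E (x i) (x (i + 1)) w)
        - increment E (x i) (x (i + 1)) w)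
    (fun i => K (increment E (x i) (x (i + 1)) w)) (c := δ) (by positivity)
    (fun i hi j hj hij => by
      have e : ∀ k, (ξ k : ℂ) • K (increment E (x k) (x (k + 1)) w)
          - increment E (x k) (x (k + 1)) w
          = increment E (x k) (x (k + 1)) ((ξ k : ℂ) • K w - w) := fun k => by
        rw [map_sub, map_smul, hE.map_increment]
      rw [e, e]
      exact hE.inner_increment_eq_zero hx' (Finset.mem_range.1 hi) (Finset.mem_range.1 hj) hij _ _)
    (fun i hi j hj hij => by
      rw [hE.map_increment, hE.map_increment]
      exact hE.inner_increment_eq_zero hx' (Finset.mem_range.1 hi) (Finset.mem_range.1 hj) hij _ _)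
    (fun i hi => by
      obtain ⟨h1, h2, h3⟩ := hx i (Finset.mem_range.1 hi)
      rw [norm_sub_rev]
      refine (hE.norm_sub_smul_le _ _ _ _ h1 h2
        (hE.increment_increment_self (h1.trans h2) w)).trans ?_
      exact mul_le_mul_of_nonneg_right h3.le (norm_nonneg _))
  rw [← map_sum, hsum] at hle
  refine hle.trans_lt ?_
  rw [div_mul_eq_mul_div, div_lt_iff₀ hc]
  nlinarith [norm_nonneg (K w)]

theorem isSpectralResolution (hE : IsSpectralFamily K E) (hK : IsSelfAdjoint K)
    {H : Y →ₗ.[ℂ] Y} (hH : IsInverseOf H K) : IsSpectralResolution H E where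
  projection := hE.projection
  mono := hE.mono
  right_continuous := hE.right_continuous
  tendsto_atBot := hE.tendsto_atBot
  tendsto_atTop := hE.tendsto_atTop
  integral z w := by
    rw [hH]
    constructor
    · rintro rfl
      refine ⟨fun a b => increment E a b w, fun a b hab => ?_,
        tendsto_increment (hE.tendsto_atBot w) (hE.tendsto_atTop w)⟩
      exact hE.hasStieltjesIntegralOn_id (hE.increment_increment_self hab w)
        (hE.map_increment a b w)
    -- Applying `K` to the integral over `[a, b]` gives the increment of `z`, so in the limit `K w =
    -- z`.
    · rintro ⟨G, hG, hlim⟩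
      refine tendsto_nhds_unique ((K.continuous.tendsto w).comp hlim)
        ((tendsto_increment (hE.tendsto_atBot z) (hE.tendsto_atTop z)).congr' ?_)
      filter_upwards [eventually_le_atBot_prod_atTop] with p hp
      obtain ⟨v, hv, hKv⟩ := hE.exists_map_eq_increment hK hH.injective hp z
      rw [Function.comp_apply, (hG p.1 p.2 hp).unique hp (hE.hasStieltjesIntegralOn_id hv hKv),
        hKv]

end IsSpectralFamily

/-! ### From an arbitrary spectral resolution back to a spectral family -/

section StieltjesMap

variable {𝕜 F F' : Type*} [NormedField 𝕜] [NormedAddCommGroup F] [NormedSpace 𝕜 F]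
  [NormedAddCommGroup F'] [NormedSpace 𝕜 F']

theorem HasStieltjesIntegralOn.map {f : ℝ → 𝕜} {g : ℝ → F} {a b : ℝ} {I : F}
    (h : HasStieltjesIntegralOn f g a b I) (T : F →+ F') {C : ℝ} (hC : ∀ y, ‖T y‖ ≤ C * ‖y‖)
    (hT : ∀ ω y, T (f ω • y) = f ω • T y) :
    HasStieltjesIntegralOn f (fun ω => T (g ω)) a b (T I) := by
  intro ε hε
  have hC1 : 0 < |C| + 1 := by positivity
  obtain ⟨δ, hδ, H⟩ := h (ε / (|C| + 1)) (by positivity)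
  refine ⟨δ, hδ, fun n x ξ h0 hn hx => ?_⟩
  have h1 := H n x ξ h0 hn hx
  simp only [← map_sub, ← hT, ← map_sum]
  refine (hC _).trans_lt ?_
  rw [lt_div_iff₀ hC1] at h1
  nlinarith [norm_nonneg ((∑ i ∈ Finset.range n, f (ξ i) • (g (x (i + 1)) - g (x i))) - I),
    le_abs_self C]

end StieltjesMap

theorem IsSpectralResolution.isProjectionFamily {H : Y →ₗ.[ℂ] Y} {E : ℝ → Y →L[ℂ] Y}
    (hE : IsSpectralResolution H E) : IsProjectionFamily E :=
  ⟨hE.projection, hE.mono⟩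

/-- Each `E μ` is bounded and commutes with the family, so it passes through the integral defining
`H` and maps the graph of `H` into itself. -/
theorem IsSpectralResolution.commute_op {H : Y →ₗ.[ℂ] Y} {E : ℝ → Y →L[ℂ] Y}
    (hE : IsSpectralResolution H E) {K : Y →L[ℂ] Y} (hH : IsInverseOf H K) (μ : ℝ) :
    Commute K (E μ) := by
  have hP := hE.isProjectionFamily
  ext w
  change K (E μ w) = E μ (K w)
  rw [← hH, hE.integral]
  obtain ⟨G, hG, hlim⟩ := (hE.integral _ _).1 ((hH (K w) w).2 rfl)
  refine ⟨fun a b => E μ (G a b), fun a b hab => ?_, ((E μ).continuous.tendsto w).comp hlim⟩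
  have h := (hG a b hab).map (E μ : Y →+ Y) (E μ).le_opNorm fun ω y => (E μ).map_smul _ _
  have e : (fun ω => E ω (E μ (K w))) = fun ω => E μ (E ω (K w)) := by
    ext ω
    exact hP.apply_comm _ _ _
  rw [e]
  exact h

theorem IsSpectralResolution.exists_mem_graph {H : Y →ₗ.[ℂ] Y} {E : ℝ → Y →L[ℂ] Y}
    (hE : IsSpectralResolution H E) {a b : ℝ} (hab : a ≤ b) {v : Y}
    (hv : increment E a b v = v) :
    ∃ I, (v, I) ∈ H.graph ∧ ∀ ξ, a ≤ ξ → ξ ≤ b → ‖I - (ξ : ℂ) • v‖ ≤ (b - a) * ‖v‖ := by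
  have hP := hE.isProjectionFamily
  obtain ⟨I, hI, hbound⟩ := exists_integral_id hP hab hv
  refine ⟨I, (hE.integral _ _).2 ?_, hbound⟩
  -- Convergence over the line requires the integral over every `[A, B]`, also when it does not
  -- contain `[a, b]`. There `v` may be replaced by its increment over `[A, B]`, which has the same
  -- increments inside. For `A > B` the value is irrelevant and set to `0`.
  have hloc : ∀ A B : ℝ, ∃ J : Y, A ≤ B →
      HasStieltjesIntegralOn (fun ω : ℝ => (ω : ℂ)) (fun ω => E ω v) A B J := by
    intro A B
    by_cases hAB : A ≤ B
    · obtain ⟨J, hJ, -⟩ := exists_integral_id hP hAB (hP.increment_increment_self hAB v)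
      refine ⟨J, fun _ ε hε => ?_⟩
      obtain ⟨δ, hδ, h⟩ := hJ A B le_rfl le_rfl ε hε
      refine ⟨δ, hδ, fun n x ξ h0 hn hx => ?_⟩
      have hx' : IsTagged n x ξ δ := hx
      have h1 := h n x ξ h0 hn hx
      refine lt_of_eq_of_lt (congrArg norm (congrArg (· - J) ?_)) h1
      refine Finset.sum_congr rfl fun i hi => congrArg _ ?_
      have hi' := Finset.mem_range.1 hi
      have h2 := hP.increment_increment_of_subset (hx'.mono (Nat.zero_le i) hi'.le)
        (hx'.mono (Nat.le_succ i) hi') (hx'.mono (Nat.succ_le_of_lt hi') le_rfl) v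
      rw [h0, hn, hP.increment_comm] at h2
      exact h2.symm
    · exact ⟨0, fun h => absurd h hAB⟩
  choose G hG using hloc
  refine ⟨G, fun A B => hG A B, tendsto_const_nhds.congr' (f₁ := fun _ => I) ?_⟩
  filter_upwards [(eventually_le_atBot a).prod_mk (eventually_ge_atTop b)] with p hp
  have hle : p.1 ≤ p.2 := hp.1.trans (hab.trans hp.2)
  exact (hI p.1 p.2 hp.1 hp.2).unique hle (hG p.1 p.2 hle)

/-- The integral estimate is applied to `K v`, which lies in the same spectral interval; its image
under `H` is `v` because `K` is injective. -/
theorem IsSpectralResolution.isSpectralFamily {H : Y →ₗ.[ℂ] Y} {E : ℝ → Y →L[ℂ] Y}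
    (hE : IsSpectralResolution H E) {K : Y →L[ℂ] Y} (hH : IsInverseOf H K) :
    IsSpectralFamily K E where
  projection := hE.projection
  mono := hE.mono
  right_continuous := hE.right_continuous
  tendsto_atBot := hE.tendsto_atBot
  tendsto_atTop := hE.tendsto_atTop
  commute_op := hE.commute_op hH
  norm_sub_smul_le a b ξ v ha hb hv := by
    have hcomm : K (increment E a b v) = increment E a b (K v) :=
      DFunLike.congr_fun ((hE.commute_op hH b).sub_right (hE.commute_op hH a)) v
    obtain ⟨I, hI, hbound⟩ := hE.exists_mem_graph (ha.trans hb) (v := K v) (by rw [← hcomm, hv])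
    rw [hH] at hI
    have h := hbound ξ ha hb
    rwa [hH.injective hI] at h

/-! ### Spectral representation of solutions -/

section Propagation

theorem hasDerivAt_cexp_mul (ξ s : ℝ) :
    HasDerivAt (fun s : ℝ => Complex.exp ((ξ * s : ℝ) * Complex.I))
      (Complex.exp ((ξ * s : ℝ) * Complex.I) * (ξ * Complex.I)) s := by
  have h1 : HasDerivAt (fun s : ℝ => ((ξ * s : ℝ) : ℂ) * Complex.I) (ξ * Complex.I) s := by
    have h2 : HasDerivAt (fun s : ℝ => ξ * s) ξ s := by
      simpa using (hasDerivAt_id s).const_mul ξ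
    exact h2.ofReal_comp.mul_const Complex.I
  exact h1.cexp

variable {K : Y →L[ℂ] Y} {E : ℝ → Y →L[ℂ] Y}

/-- A solution that is nearly an eigenvector for `ξ` nearly rotates with frequency `ξ`. -/
theorem IsEvolution.norm_sub_rotation_le (hK : IsSelfAdjoint K) {p : ℝ → Y}
    (hp : IsEvolution K p) {ξ δ : ℝ} (h : ∀ s, ‖p s - (ξ : ℂ) • K (p s)‖ ≤ δ * ‖K (p s)‖) (t : ℝ) :
    ‖Complex.exp (-(ξ * t : ℝ) * Complex.I) • K (p 0) - K (p t)‖ ≤ δ * |t| * ‖K (p 0)‖ := by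
  -- Undoing the rotation leaves a function with derivative `-i e^{iξs} (p s - ξ K (p s))`, small by
  -- hypothesis; the mean value inequality does the rest.
  let g : ℝ → Y := fun s => Complex.exp ((ξ * s : ℝ) * Complex.I) • K (p s)
  have hg : ∀ s, HasDerivAt g (Complex.exp ((ξ * s : ℝ) * Complex.I) • -(Complex.I • p s)
      + (Complex.exp ((ξ * s : ℝ) * Complex.I) * (ξ * Complex.I)) • K (p s)) s := fun s =>
    (hasDerivAt_cexp_mul ξ s).smul (hp.hasDerivAt s)
  have hbound : ∀ s ∈ (Set.univ : Set ℝ),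
      ‖Complex.exp ((ξ * s : ℝ) * Complex.I) • -(Complex.I • p s)
      + (Complex.exp ((ξ * s : ℝ) * Complex.I) * (ξ * Complex.I)) • K (p s)‖
      ≤ δ * ‖K (p 0)‖ := by
    intro s _
    have e : Complex.exp ((ξ * s : ℝ) * Complex.I) • -(Complex.I • p s)
        + (Complex.exp ((ξ * s : ℝ) * Complex.I) * (ξ * Complex.I)) • K (p s)
        = (-(Complex.exp ((ξ * s : ℝ) * Complex.I) * Complex.I)) • (p s - (ξ : ℂ) • K (p s)) := by
      module
    rw [e, norm_smul, norm_neg, norm_mul, Complex.norm_I, Complex.norm_exp_ofReal_mul_I, one_mul,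
      one_mul, ← hp.norm_map_eq hK s]
    exact h s
  have h1 := convex_univ.norm_image_sub_le_of_norm_hasDerivWithin_le (f := g)
    (fun s _ => (hg s).hasDerivWithinAt) hbound (Set.mem_univ 0) (Set.mem_univ t)
  have e : Complex.exp (-(ξ * t : ℝ) * Complex.I) • K (p 0) - K (p t)
      = (-Complex.exp (-(ξ * t : ℝ) * Complex.I)) • (g t - g 0) := by
    have e1 : Complex.exp (-(ξ * t : ℝ) * Complex.I) * Complex.exp ((ξ * t : ℝ) * Complex.I)
        = 1 := by
      rw [← Complex.exp_add]; simp
    have e2 : g 0 = K (p 0) := by simp [g]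
    rw [e2, smul_sub, neg_smul, neg_smul, smul_smul, e1, one_smul]
    abel
  rw [e, norm_smul, norm_neg, ← Complex.ofReal_neg, Complex.norm_exp_ofReal_mul_I, one_mul]
  refine h1.trans (le_of_eq ?_)
  rw [sub_zero, Real.norm_eq_abs]
  ring

/-- The spectral representation of the solutions. -/
theorem IsSpectralFamily.hasStieltjesIntegralOn_exp (hE : IsSpectralFamily K E)
    (hK : IsSelfAdjoint K) {q : ℝ → Y} (hq : IsEvolution K q) (t : ℝ) {a b : ℝ} (hab : a ≤ b) :
    HasStieltjesIntegralOn (fun ω : ℝ => Complex.exp (-(ω * t : ℝ) * Complex.I))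
      (fun ω => E ω (q 0)) a b (increment E a b (q t)) := by
  intro ε hε
  set c := b - a + |a| with hc
  have hc0 : 0 ≤ c := by
    have := abs_nonneg a
    linarith
  have hd : 0 < c * (|t| * ‖K (q 0)‖) + 1 := by positivity
  refine ⟨ε / (c * (|t| * ‖K (q 0)‖) + 1), by positivity, fun n x ξ hx0 hxn hx => ?_⟩
  set δ := ε / (c * (|t| * ‖K (q 0)‖) + 1) with hδ
  have hδ0 : 0 < δ := by positivity
  have hx' : IsTagged n x ξ δ := hx
  set e : ℕ → ℂ := fun i => Complex.exp (-(ξ i * t : ℝ) * Complex.I) with he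
  -- The error on one spectral piece. The rotation estimate bounds only `K (d i)`; after orthogonal
  -- summation `K` is removed by its lower bound with constant `c` on the interval from `a` to `b`,
  -- which explains the choice of `δ`.
  let d : ℕ → Y := fun i => increment E (x i) (x (i + 1)) (e i • q 0 - q t)
  have hsum : (∑ i ∈ Finset.range n, e i • (E (x (i + 1)) (q 0) - E (x i) (q 0)))
      - increment E a b (q t) = ∑ i ∈ Finset.range n, d i := by
    simp only [d, map_sub, Finset.sum_sub_distrib, sum_increment, hx0, hxn, map_smul]
    rfl
  rw [hsum]
  have hrange : increment E a b (∑ i ∈ Finset.range n, d i) = ∑ i ∈ Finset.range n, d i := by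
    rw [map_sum]
    refine Finset.sum_congr rfl fun i hi => ?_
    have hi' := Finset.mem_range.1 hi
    rw [← hx0, ← hxn]
    exact hE.increment_increment_of_subset (hx'.mono (Nat.zero_le i) hi'.le)
      (hx'.mono (Nat.le_succ i) hi') (hx'.mono (Nat.succ_le_of_lt hi') le_rfl) _
  have hle := norm_sum_le_of_orthogonal (Finset.range n) (fun i => K (d i))
    (fun i => K (increment E (x i) (x (i + 1)) (q 0))) (c := δ * |t|) (by positivity)
    (fun i hi j hj hij => by
      simp only [d]
      rw [hE.map_increment, hE.map_increment]
      exact hE.inner_increment_eq_zero hx' (Finset.mem_range.1 hi) (Finset.mem_range.1 hj) hij _ _)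
    (fun i hi j hj hij => by
      rw [hE.map_increment, hE.map_increment]
      exact hE.inner_increment_eq_zero hx' (Finset.mem_range.1 hi) (Finset.mem_range.1 hj) hij _ _)
    (fun i hi => by
      obtain ⟨h1, h2, h3⟩ := hx i (Finset.mem_range.1 hi)
      have h4 := (hq.map (hE.commute_increment (x i) (x (i + 1)))).norm_sub_rotation_le hK
        (ξ := ξ i) (δ := δ) (fun s => (hE.norm_sub_smul_le _ _ _ _ h1 h2
          (hE.increment_increment_self (h1.trans h2) (q s))).trans
          (mul_le_mul_of_nonneg_right h3.le (norm_nonneg _))) t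
      simpa only [d, map_sub, map_smul] using h4)
  rw [← map_sum, ← map_sum, sum_increment, hx0, hxn] at hle
  have h5 : ‖K (increment E a b (q 0))‖ ≤ ‖K (q 0)‖ := by
    rw [hE.map_increment]
    exact hE.norm_increment_le hab _
  calc ‖∑ i ∈ Finset.range n, d i‖ ≤ c * ‖K (∑ i ∈ Finset.range n, d i)‖ := hE.norm_le hab hrange
    _ ≤ c * (δ * |t| * ‖K (q 0)‖) := by
        gcongr
        exact hle.trans (by gcongr)
    _ = ε * (c * (|t| * ‖K (q 0)‖)) / (c * (|t| * ‖K (q 0)‖) + 1) := by rw [hδ]; ring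
    _ < ε := by
        rw [div_lt_iff₀ hd]
        nlinarith

end Propagation

end

/-! ### Linear combinations and components of Stieltjes integrals -/

section Stieltjes

variable {F : Type*} [NormedAddCommGroup F] [NormedSpace ℂ F]

theorem HasStieltjesIntegralOn.linear_comb {f g : ℝ → ℂ} {G : ℝ → F} {a b : ℝ} {I I' : F}
    (hf : HasStieltjesIntegralOn f G a b I) (hg : HasStieltjesIntegralOn g G a b I') (c d : ℂ) :
    HasStieltjesIntegralOn (fun ω => c * f ω + d * g ω) G a b (c • I + d • I') := by
  intro ε hε
  have hcd : 0 < ‖c‖ + ‖d‖ + 1 := by positivity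
  obtain ⟨δ, hδ, H⟩ := hf (ε / (‖c‖ + ‖d‖ + 1)) (by positivity)
  obtain ⟨δ', hδ', H'⟩ := hg (ε / (‖c‖ + ‖d‖ + 1)) (by positivity)
  refine ⟨min δ δ', lt_min hδ hδ', fun n x ξ h0 hn hx => ?_⟩
  have e1 := H n x ξ h0 hn fun i hi => ⟨(hx i hi).1, (hx i hi).2.1,
    (hx i hi).2.2.trans_le (min_le_left _ _)⟩
  have e2 := H' n x ξ h0 hn fun i hi => ⟨(hx i hi).1, (hx i hi).2.1,
    (hx i hi).2.2.trans_le (min_le_right _ _)⟩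
  simp only [add_smul, mul_smul, Finset.sum_add_distrib, ← Finset.smul_sum]
  set S := ∑ i ∈ Finset.range n, f (ξ i) • (G (x (i + 1)) - G (x i))
  set S' := ∑ i ∈ Finset.range n, g (ξ i) • (G (x (i + 1)) - G (x i))
  have e : c • S + d • S' - (c • I + d • I') = c • (S - I) + d • (S' - I') := by module
  rw [e]
  refine (norm_add_le _ _).trans_lt ?_
  rw [norm_smul, norm_smul]
  have hm : 0 < ε / (‖c‖ + ‖d‖ + 1) := by positivity
  have hme : ε / (‖c‖ + ‖d‖ + 1) * (‖c‖ + ‖d‖ + 1) = ε := div_mul_cancel₀ _ hcd.ne'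
  have h1 := mul_le_mul_of_nonneg_left e1.le (norm_nonneg c)
  have h2 := mul_le_mul_of_nonneg_left e2.le (norm_nonneg d)
  linarith

end Stieltjes

section Components

variable {X : Type*} [NormedAddCommGroup X] [InnerProductSpace ℝ X]

theorem HasStieltjesIntegralOn.re_im {f : ℝ → ℝ} {G : ℝ → Complexification X} {a b : ℝ}
    {I : Complexification X} (h : HasStieltjesIntegralOn (fun ω => (f ω : ℂ)) G a b I) :
    HasStieltjesIntegralOn f (fun ω => re (G ω)) a b (re I) ∧
      HasStieltjesIntegralOn f (fun ω => im (G ω)) a b (im I) := by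
  have h' : HasStieltjesIntegralOn f G a b I := by
    intro ε hε
    obtain ⟨δ, hδ, H⟩ := h ε hε
    refine ⟨δ, hδ, fun n x ξ h0 hn hx => ?_⟩
    have := H n x ξ h0 hn hx
    simpa only [Complex.coe_smul] using this
  exact ⟨h'.map (reCLM (X := X) : Complexification X →+ X) (C := 1)
      (fun y => by rw [one_mul]; exact norm_re_le y) fun ω y => re_real_smul _ _,
    h'.map (imCLM (X := X) : Complexification X →+ X) (C := 1)
      (fun y => by rw [one_mul]; exact norm_im_le y) fun ω y => im_real_smul _ _⟩

end Components

/-! ### Return to the real Hamilton equation -/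

section Hamilton

variable {X : Type*} [NormedAddCommGroup X] [InnerProductSpace ℝ X] [CompleteSpace X]
  {B : X →ₗ.[ℝ] X} {R J : X →L[ℝ] X}

theorem sqrtMap_bijective (h : IsInverseOf (opSqrt B) R) :
    Function.Bijective (EnergySpace.sqrtMap B) := h.bijective

theorem incl_eq (h : IsInverseOf (opSqrt B) R) (x : EnergySpace B) :
    EnergySpace.incl B x = R (EnergySpace.sqrtMap B x) :=
  ((h _ _).1 ((opSqrt B).mem_graph x)).symm

theorem continuous_sqrtMap : Continuous (EnergySpace.sqrtMap B) :=
  continuous_induced_dom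

theorem intervalIntegral_map {V W : Type*} [NormedAddCommGroup V] [NormedSpace ℝ V]
    [CompleteSpace V] [NormedAddCommGroup W] [NormedSpace ℝ W] [CompleteSpace W]
    (T : V →L[ℝ] W) {y : ℝ → V} (hy : Continuous y) (t : ℝ) :
    ∫ s in (0 : ℝ)..t, T (y s) = T (∫ s in (0 : ℝ)..t, y s) :=
  T.intervalIntegral_comp_comm (hy.intervalIntegrable _ _)

/-- Mild solutions correspond, under `B^{1/2}`, to mild solutions in the complexification. -/
theorem isMildSolution_iff (hB : IsInverseOf B (R * R)) (h : IsInverseOf (opSqrt B) R)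
    (hJ : J.comp J = -1) (u : C(ℝ, EnergySpace B)) :
    IsMildSolution J B u ↔
      IsEvolution (generatorInverse R J) fun t => ofReal (EnergySpace.sqrtMap B (u t)) := by
  have hJ' : ∀ x, J (J x) = -x := fun x => DFunLike.congr_fun hJ x
  have hJinj : Function.Injective J := fun x y hxy => by
    have := congrArg J hxy
    rwa [hJ', hJ', neg_inj] at this
  set y : ℝ → X := fun t => EnergySpace.sqrtMap B (u t) with hy
  have hyc : Continuous y := continuous_sqrtMap.comp u.continuous
  have hincl : ∀ t, EnergySpace.incl B (u t) = R (y t) := fun t => incl_eq h _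
  have hint : ∀ t, ∫ s in (0 : ℝ)..t, R (y s) = R (∫ s in (0 : ℝ)..t, y s) :=
    intervalIntegral_map R hyc
  -- Applying `R J` to the equation turns it into one for `y = Λ u` with bounded operators only.
  -- Conversely, this equation exhibits `∫ R y` in the range of `R²`, which is `D(B)`.
  have hreal : IsMildSolution J B u ↔
      ∀ t, skewInverse R J (y t - y 0) = -∫ s in (0 : ℝ)..t, y s := by
    refine forall_congr' fun t => ?_
    simp only [hincl, hint, ← map_sub]
    set I := ∫ s in (0 : ℝ)..t, y s
    change _ ↔ R (J (R (y t - y 0))) = -I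
    constructor
    · rintro ⟨hmem, he⟩
      have h1 : R (R (B ⟨R I, hmem⟩)) = R I := (hB _ _).1 (B.mem_graph ⟨R I, hmem⟩)
      rw [he, hJ', map_neg, h.injective h1]
    · intro he
      have hg : (R I, -J (R (y t - y 0))) ∈ B.graph := by
        rw [hB]
        change R (R (-J (R (y t - y 0)))) = R I
        rw [map_neg, he, neg_neg]
      obtain ⟨c, hc, hc'⟩ := (LinearPMap.mem_graph_iff _).1 hg
      simp only at hc hc'
      have hmem : R I ∈ B.domain := hc ▸ c.2
      refine ⟨hmem, ?_⟩
      rw [show (⟨R I, hmem⟩ : B.domain) = c from Subtype.ext hc.symm, hc', map_neg, hJ', neg_neg]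
  rw [hreal]
  have hoint : ∀ t, ∫ s in (0 : ℝ)..t, ofReal (y s) = ofReal (∫ s in (0 : ℝ)..t, y s) :=
    fun t => intervalIntegral_map ofRealCLM hyc t
  have hK : ∀ t, generatorInverse R J (ofReal (y t) - ofReal (y 0))
      = Complex.I • ofReal (skewInverse R J (y t - y 0)) := fun t => by
    rw [← mapCLM_ofReal]
    exact congrArg (generatorInverse R J) ((ofRealCLM (X := X)).map_sub _ _).symm
  constructor
  · intro H
    refine ⟨ofRealCLM.continuous.comp hyc, fun t => ?_⟩
    rw [hK, H, hoint, ← smul_neg]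
    exact congrArg _ ((ofRealCLM (X := X)).map_neg _)
  · intro H t
    have h1 := H.mild t
    rw [hK, hoint, ← smul_neg] at h1
    have h2 := smul_right_injective _ Complex.I_ne_zero h1
    simpa using congrArg re h2

/-- Cancelling `i`, the equation reads `R J R (q t - q 0) = -∫ q` with a real operator, so it may be
taken componentwise. -/
theorem isEvolution_re {q : ℝ → Complexification X} (hq : IsEvolution (generatorInverse R J) q) :
    IsEvolution (generatorInverse R J) fun t => ofReal (re (q t)) := by
  refine ⟨ofRealCLM.continuous.comp (reCLM.continuous.comp hq.continuous), fun t => ?_⟩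
  have h := hq.mild t
  have h1 : mapCLM (skewInverse R J) (q t - q 0) = -∫ s in (0 : ℝ)..t, q s := by
    apply smul_right_injective _ Complex.I_ne_zero
    change Complex.I • _ = Complex.I • _
    rw [smul_neg, ← h]
    rfl
  have h2 := congrArg re h1
  rw [re_mapCLM, re_sub, re_neg, ← reCLM_apply (∫ s in (0 : ℝ)..t, q s),
    ← intervalIntegral_map reCLM hq.continuous] at h2
  have h3 : ∫ s in (0 : ℝ)..t, ofReal (re (q s)) = ofReal (∫ s in (0 : ℝ)..t, re (q s)) :=
    intervalIntegral_map ofRealCLM (reCLM.continuous.comp hq.continuous) t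
  rw [h3]
  have h4 : generatorInverse R J (ofReal (re (q t)) - ofReal (re (q 0)))
      = Complex.I • ofReal (skewInverse R J (re (q t) - re (q 0))) := by
    rw [← mapCLM_ofReal]
    exact congrArg (generatorInverse R J) ((ofRealCLM (X := X)).map_sub _ _).symm
  rw [h4, h2, ← smul_neg]
  exact congrArg _ ((ofRealCLM (X := X)).map_neg _)

theorem ofReal_injective : Function.Injective (ofReal (X := X)) := fun _ _ h => congrArg re h

theorem norm_ofReal (x : X) : ‖ofReal x‖ = ‖x‖ := by
  rw [← sq_eq_sq₀ (norm_nonneg _) (norm_nonneg _), norm_sq]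
  simp

theorem existsUnique_isMildSolution (hB : IsInverseOf B (R * R)) (h : IsInverseOf (opSqrt B) R)
    (hJ : J.comp J = -1) (hK : IsSelfAdjoint (generatorInverse R J))
    (hinj : Function.Injective (generatorInverse R J)) (x₀ : EnergySpace B) :
    ∃! u : C(ℝ, EnergySpace B), u 0 = x₀ ∧ IsMildSolution J B u := by
  obtain ⟨q, hq, hq0⟩ := exists_isEvolution hK hinj (ofReal (EnergySpace.sqrtMap B x₀))
  let e := Equiv.ofBijective _ (sqrtMap_bijective h)
  have he : ∀ y, EnergySpace.sqrtMap B (e.symm y) = y := fun y => e.apply_symm_apply y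
  -- The topology of `𝒱` is induced by `Λ`, so continuity into `𝒱` is continuity of `re (q t)`.
  let u : C(ℝ, EnergySpace B) := ⟨fun t => e.symm (re (q t)), by
    rw [continuous_induced_rng]
    have : (EnergySpace.sqrtMap B ∘ fun t => e.symm (re (q t))) = fun t => re (q t) := by
      ext t
      exact he _
    exact this ▸ reCLM.continuous.comp hq.continuous⟩
  have hu : ∀ t, EnergySpace.sqrtMap B (u t) = re (q t) := fun t => he _
  refine ⟨u, ⟨?_, ?_⟩, ?_⟩
  · apply (sqrtMap_bijective h).1
    rw [hu, hq0, re_ofReal]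
  · rw [isMildSolution_iff hB h hJ]
    simp only [hu]
    exact isEvolution_re hq
  · rintro v ⟨hv0, hv⟩
    rw [isMildSolution_iff hB h hJ] at hv
    have h1 := IsEvolution.unique hK hinj hv (isEvolution_re hq)
      (by simp only [hv0, hq0, re_ofReal])
    ext t
    apply (sqrtMap_bijective h).1
    rw [hu]
    exact ofReal_injective (congrFun h1 t)

/-- Half the sum of the exponential representations at `t` and `-t` is the cosine integral, and
`i/2` times their difference is the sine integral. As `y` is real, the first value is real and the
second purely imaginary, so the real and the imaginary component respectively lose nothing. -/
theorem exists_integral_cos_sin {K : Complexification X →L[ℂ] Complexification X}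
    {E : ℝ → Complexification X →L[ℂ] Complexification X} (hE : IsSpectralFamily K E)
    (hK : IsSelfAdjoint K) {y : ℝ → X} (hy : IsEvolution K fun t => ofReal (y t)) (t : ℝ) :
    HasStieltjesIntegral (fun ω : ℝ => Real.cos (ω * t)) (fun ω => realComponent E ω (y 0))
        ((1 / 2 : ℝ) • (y t + y (-t))) ∧
      HasStieltjesIntegral (fun ω : ℝ => Real.sin (ω * t)) (fun ω => imagComponent E ω (y 0))
        ((1 / 2 : ℝ) • (y t - y (-t))) := by
  have hexp : ∀ s a b, a ≤ b → HasStieltjesIntegralOn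
      (fun ω : ℝ => Complex.exp (-(ω * s : ℝ) * Complex.I)) (fun ω => E ω (ofReal (y 0))) a b
      (increment E a b (ofReal (y s))) := fun s a b hab =>
    hE.hasStieltjesIntegralOn_exp hK hy s hab
  have hlim : ∀ c d : ℂ, Tendsto (fun p : ℝ × ℝ => c • increment E p.1 p.2 (ofReal (y t))
      + d • increment E p.1 p.2 (ofReal (y (-t)))) (atBot ×ˢ atTop)
      (𝓝 (c • ofReal (y t) + d • ofReal (y (-t)))) := fun c d =>
    ((tendsto_increment (hE.tendsto_atBot _) (hE.tendsto_atTop _)).const_smul c).add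
      ((tendsto_increment (hE.tendsto_atBot _) (hE.tendsto_atTop _)).const_smul d)
  constructor
  · refine ⟨fun a b => re ((1 / 2 : ℂ) • increment E a b (ofReal (y t))
      + (1 / 2 : ℂ) • increment E a b (ofReal (y (-t)))), fun a b hab => ?_, ?_⟩
    · have h := (hexp t a b hab).linear_comb (hexp (-t) a b hab) (1 / 2) (1 / 2)
      refine (HasStieltjesIntegralOn.re_im (f := fun ω => Real.cos (ω * t)) ?_).1
      convert h using 2 with ω
      rw [Complex.ofReal_cos, Complex.cos]
      push_cast
      ring_nf
    · have h := (reCLM (X := X)).continuous.continuousAt.tendsto.comp (hlim (1 / 2) (1 / 2))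
      have e : reCLM ((1 / 2 : ℂ) • ofReal (y t) + (1 / 2 : ℂ) • ofReal (y (-t)))
          = (1 / 2 : ℝ) • (y t + y (-t)) := by
        simp
      rw [e] at h
      exact h
  · refine ⟨fun a b => im ((Complex.I / 2) • increment E a b (ofReal (y t))
      + (-Complex.I / 2) • increment E a b (ofReal (y (-t)))), fun a b hab => ?_, ?_⟩
    · have h := (hexp t a b hab).linear_comb (hexp (-t) a b hab) (Complex.I / 2) (-Complex.I / 2)
      refine (HasStieltjesIntegralOn.re_im (f := fun ω => Real.sin (ω * t)) ?_).2
      convert h using 2 with ω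
      rw [Complex.ofReal_sin, Complex.sin]
      push_cast
      ring_nf
    · have h := (imCLM (X := X)).continuous.continuousAt.tendsto.comp
        (hlim (Complex.I / 2) (-Complex.I / 2))
      have e : imCLM ((Complex.I / 2) • ofReal (y t) + (-Complex.I / 2) • ofReal (y (-t)))
          = (1 / 2 : ℝ) • (y t - y (-t)) := by
        simp [sub_eq_add_neg, neg_div]
      rw [e] at h
      exact h

/-- One real operator `R` governs both square roots: uniqueness over the complex numbers identifies
the inverse of the complex root with the complexification of `R`. -/
theorem exists_isInverseOf_sqrt (hB : IsSelfAdjoint B) (hB_nonneg : IsNonneg B)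
    (hB_inv : Function.Bijective B) :
    (∃! S, IsPosSqrt B S) ∧ (∃! S, IsPosSqrt (mapLinearPMap B) S) ∧
      ∃ R : X →L[ℝ] X, R.IsPositive ∧ IsInverseOf B (R * R) ∧ IsInverseOf (opSqrt B) R ∧
        IsInverseOf (opSqrt (mapLinearPMap B)) (mapCLM R) := by
  obtain ⟨A, hA, hBA⟩ := exists_isPositive_isInverseOf hB hB_nonneg hB_inv
  have hBA' := isInverseOf_mapLinearPMap hBA
  have h1 := existsUnique_isPosSqrt hBA (existsUnique_sqrt_real hA)
  have h2 := existsUnique_isPosSqrt hBA' (existsUnique_sqrt_complex (mapCLM_isPositive hA))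
  have hS : IsPosSqrt B (opSqrt B) := Classical.epsilon_spec h1.exists
  have hS' : IsPosSqrt (mapLinearPMap B) (opSqrt (mapLinearPMap B)) :=
    Classical.epsilon_spec h2.exists
  obtain ⟨R, hR, hRA, hSR⟩ := (isPosSqrt_iff hBA).1 hS
  obtain ⟨Q, hQ, hQA, hSQ⟩ := (isPosSqrt_iff hBA').1 hS'
  have hQR : Q = mapCLM R := (existsUnique_sqrt_complex (mapCLM_isPositive hA)).unique ⟨hQ, hQA⟩
    ⟨mapCLM_isPositive hR, by rw [← mapCLM_mul, hRA]⟩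
  exact ⟨h1, h2, R, hR, hRA ▸ hBA, hSR, hQR ▸ hSQ⟩

end Hamilton

end

end HamiltonSpectral

theorem corollary2p5 {X : Type*} [NormedAddCommGroup X] [InnerProductSpace ℝ X] [CompleteSpace X]
    (B : X →ₗ.[ℝ] X) (hB : IsSelfAdjoint B) (hB_nonneg : IsNonneg B)
    (hB_inv : Function.Bijective B)
    (J : X →L[ℝ] X) (hJ : ContinuousLinearMap.adjoint J = -J) (hJ_sq : J.comp J = -1) :
    -- the square roots of `B` and of its complexification are well defined,
    -- and `B^{1/2} : 𝒱 → X` is invertible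
    (∃! S, IsPosSqrt B S) ∧
    (∃! S, IsPosSqrt (Complexification.mapLinearPMap B) S) ∧
    Function.Bijective (opSqrt B) ∧
    -- existence and uniqueness
    (∀ x₀ : EnergySpace B, ∃! u : C(ℝ, EnergySpace B), u 0 = x₀ ∧ IsMildSolution J B u) ∧
    -- energy conservation
    (∀ u : C(ℝ, EnergySpace B), IsMildSolution J B u →
      ∀ t : ℝ, EnergySpace.energy B (u t) = EnergySpace.energy B (u 0)) ∧
    -- spectral representation
    (∃ E, IsSpectralResolution (complexGenerator J B) E) ∧
    ∀ E, IsSpectralResolution (complexGenerator J B) E →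
      ∀ u : C(ℝ, EnergySpace B), IsMildSolution J B u → ∀ t : ℝ, ∃ I₁ I₂ : X,
        HasStieltjesIntegral (fun ω : ℝ => Real.cos (ω * t))
          (fun ω => realComponent E ω (EnergySpace.sqrtMap B (u 0))) I₁ ∧
        HasStieltjesIntegral (fun ω : ℝ => Real.sin (ω * t))
          (fun ω => imagComponent E ω (EnergySpace.sqrtMap B (u 0))) I₂ ∧
        ∃ h : I₁ + I₂ ∈ (opSqrt B).inverse.domain,
          EnergySpace.incl B (u t) = (opSqrt B).inverse ⟨I₁ + I₂, h⟩ := by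
  obtain ⟨hS, hS', R, hR, hBR, hSR, hSR'⟩ := exists_isInverseOf_sqrt hB hB_nonneg hB_inv
  have hH := complexGenerator_isInverseOf hSR' hJ_sq
  have hK := generatorInverse_isSelfAdjoint hR hJ
  refine ⟨hS, hS', hSR.bijective,
    existsUnique_isMildSolution hBR hSR hJ_sq hK hH.injective, fun u hu t => ?_, ?_, ?_⟩
  -- The energy is half the squared norm of `Λ u`, which the evolution conserves.
  · rw [isMildSolution_iff hBR hSR hJ_sq] at hu
    have h := hu.norm_eq hK t
    rw [norm_ofReal, norm_ofReal] at h
    rw [EnergySpace.energy, EnergySpace.energy, real_inner_self_eq_norm_sq,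
      real_inner_self_eq_norm_sq, h]
  · obtain ⟨E, hE⟩ := exists_isSpectralFamily hK hH.injective
    exact ⟨E, hE.isSpectralResolution hK hH⟩
  · intro E hE u hu t
    rw [isMildSolution_iff hBR hSR hJ_sq] at hu
    obtain ⟨h1, h2⟩ := exists_integral_cos_sin (hE.isSpectralFamily hH) hK hu t
    refine ⟨_, _, h1, h2, ?_⟩
    -- The even and odd parts in time, given by the cosine and sine integrals, add up to `Λ u(t)`.
    have hsum : (1 / 2 : ℝ) • (EnergySpace.sqrtMap B (u t) + EnergySpace.sqrtMap B (u (-t)))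
        + (1 / 2 : ℝ) • (EnergySpace.sqrtMap B (u t) - EnergySpace.sqrtMap B (u (-t)))
        = EnergySpace.sqrtMap B (u t) := by module
    have hker : LinearMap.ker (opSqrt B).toFun = ⊥ := LinearMap.ker_eq_bot.2 hSR.bijective.1
    have hdom : ∀ y, y ∈ (opSqrt B).inverse.domain := fun y => by
      rw [LinearPMap.inverse_domain]
      exact hSR.bijective.2 y
    refine ⟨hdom _, ?_⟩
    exact (LinearPMap.inverse_apply_eq (y := ⟨_, hdom _⟩) (x := u t) hker hsum.symm).symm
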